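/- Tensors are elements of $\mathbb C^{n\times\dots\times n}$ ($d\ge 1$ modes), $\|\cdot\|$ is the Euclidean norm of the entries, $\mathbf{Mat}_i(Y)\in\mathbb C^{n\times n^{d-1}}$ is the $i$th matricization (row index $=$ $i$th index), $\mathit{Ten}_i$ its inverse, and $C\bigtimes_{i=1}^d\mathbf U$ denotes the multilinear product of $C$ with the matrix $\mathbf U$ in every mode. $Y$ has multilinear rank $(r,\dots,r)$ if every $\mathbf{Mat}_i(Y)$ has rank $r$; $\mathrm P(Y)$ is the orthogonal projection onto the tangent space at $Y$ of the manifold of such tensors. A tensor is symmetric (anti-symmetric) if each permutation $\sigma$ of its $d$ indices leaves its entries unchanged (multiplies them by the sign of $\sigma$). "(Anti-)symmetric" is to be read throughout as symmetric, or throughout as anti-symmetric. **Integrator.** One step of the (anti-)symmetric Tucker integrator for $\dot Y=F(t,Y)$ from $t_0$ to $t_1$ takes $Y_0=C_0\bigtimes_{i=1}^d\mathbf U_0$, where $\mathbf U_0\in\mathbb C^{n\times r}$ has orthonormal columns, to $Y_1=C_1\bigtimes_{i=1}^d\mathbf U_1$ as follows. Factorize $\mathbf{Mat}_1(C_0)^\top=\mathbf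 Q_0\mathbf S_0^\top$, where $\mathbf Q_0\in\mathbb C^{r^{d-1}\times r}$ has orthonormal columns, and set $\mathbf V_0^\top=\mathbf Q_0^\top\bigotimes_{i=2}^d\mathbf U_0^\top$. Solve, from $t_0$ to $t_1$, $\dot{\mathbf K}=\mathbf{Mat}_1\bigl(F(t,\mathit{Ten}_1(\mathbf K\mathbf V_0^\top))\bigr)\overline{\mathbf V}_0$, $\mathbf K(t_0)=\mathbf U_0\mathbf S_0$, and factorize $\mathbf K(t_1)=\mathbf U_1\mathbf R$, where $\mathbf U_1\in\mathbb C^{n\times r}$ has orthonormal columns. Solve, from $t_0$ to $t_1$, $\dot C=F\bigl(t,C\bigtimes_{i=1}^d\mathbf U_1\bigr)\bigtimes_{i=1}^d\mathbf U_1^*$, $C(t_0)=Y_0\bigtimes_{i=1}^d\mathbf U_1^*$, and set $C_1=C(t_1)$. **Theorem.** For every $d\ge1$, $L\ge 0$, $B\ge 0$ and $T\ge 0$ there are constants $c_0,c_1,c_2\ge0$, depending only on $L$, $B$, $T$ and $d$ (in particular not on $n$, $r$ or singular values of matricizations of the exact or approximate solution), such that the following holds. Let $A(t)$, $0\le t\le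 T$, be a solution of $\dot A(t)=F(t,A(t))$ with (anti-)symmetric initial value $A(0)=A_0$, where $F(t,Y)$ is (anti-)symmetric whenever $Y$ is. Assume, for some $\varepsilon\ge0$, $\delta\ge 0$ and $\rho>0$: 1. $\|F(t,Y)-F(t,\widetilde Y)\|\le L\|Y-\widetilde Y\|$ and $\|F(t,Y)\|\le B$ for all tensors $Y,\widetilde Y$ and $0\le t\le T$; 2. $\|(I-\mathrm P(Y))F(t,Y)\|\le\varepsilon$ for all $0\le t\le T$ and all $Y$ of multilinear rank $(r,\dots,r)$ in the neighbourhood $\|Y-A(t)\|<\rho$ of $A(t)$; 3. $\|Y_0-A_0\|\le\delta$, where $Y_0$ is (anti-)symmetric of multilinear rank $(r,\dots,r)$. Let $Y_k$ denote the approximation at $t_k=kh$ obtained after $k$ steps of the (anti-)symmetric Tucker integrator with step size $h>0$, started from $Y_0$ in a factorized form as above. If $c_0\delta+c_1\varepsilon+c_2h\le\rho$ (so that the bound does not leave the neighbourhood in condition 2), then for all $k$ with $t_k=kh\le T$ $$\|Y_k-A(t_k)\|\le c_0\delta+c_1\varepsilon+c_2h .$$ -/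

import Mathlib

open Set Filter Topology
open scoped Matrix

noncomputable section

namespace SymTucker

/-- Complex tensors of order `d` of size `n × ⋯ × n`, with the Euclidean inner product and norm of
the entries. -/
abbrev Tensor (d n : ℕ) : Type := EuclideanSpace ℂ (Fin d → Fin n)

/-- The column indices of the `i`th matricization: the multi-indices with the `i`th index left
out. -/
abbrev ColIdx {d : ℕ} (i : Fin d) (n : ℕ) : Type := {j : Fin d // j ≠ i} → Fin n

/-- The `i`th matricization: the entries whose `i`th index is `k` form the `k`th row. -/
def mat {d n : ℕ} (i : Fin d) (Y : Tensor d n) : Matrix (Fin n) (ColIdx i n) ℂ :=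
  Matrix.of fun k c => Y ((Equiv.funSplitAt i (Fin n)).symm (k, c))

/-- The retensorization, inverse to the `i`th matricization. -/
def ten {d n : ℕ} (i : Fin d) (M : Matrix (Fin n) (ColIdx i n) ℂ) : Tensor d n :=
  WithLp.toLp 2 fun x => M (Equiv.funSplitAt i (Fin n) x).1 (Equiv.funSplitAt i (Fin n) x).2

theorem ten_mat {d n : ℕ} (i : Fin d) (Y : Tensor d n) : ten i (mat i Y) = Y := by
  ext x
  simp only [ten, mat, Matrix.of_apply, Prod.mk.eta, Equiv.symm_apply_apply]

theorem mat_ten {d n : ℕ} (i : Fin d) (M : Matrix (Fin n) (ColIdx i n) ℂ) :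
    mat i (ten i M) = M := by
  ext k c
  simp only [ten, mat, Matrix.of_apply, Equiv.apply_symm_apply]

/-- `Y` has multilinear rank `(r, …, r)`. -/
def HasMultilinearRank {d n : ℕ} (r : ℕ) (Y : Tensor d n) : Prop :=
  ∀ i : Fin d, (mat i Y).rank = r

/-- The Kronecker product of copies of the matrix `U`, one for each element of `J`. -/
def kronPow (J : Type) [Fintype J] {m k : ℕ} (U : Matrix (Fin m) (Fin k) ℂ) :
    Matrix (J → Fin m) (J → Fin k) ℂ :=
  Matrix.of fun a b => ∏ j, U (a j) (b j)

/-- The multilinear product `C ×₁ U ×₂ U ⋯ ×_d U`, with the same matrix `U` in all modes. -/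
def tucker {d m k : ℕ} (C : Tensor d k) (U : Matrix (Fin m) (Fin k) ℂ) : Tensor d m :=
  WithLp.toLp 2 fun a => ∑ b : Fin d → Fin k, (∏ j, U (a j) (b j)) * C b

/-- The two structures that are treated. -/
inductive SymmetryType
  | symmetric
  | antisymmetric

/-- The factor by which a permutation of the indices changes the entries. -/
def SymmetryType.factor {d : ℕ} : SymmetryType → Equiv.Perm (Fin d) → ℂ
  | .symmetric, _ => 1
  | .antisymmetric, σ => ((Equiv.Perm.sign σ : ℤ) : ℂ)

/-- `Y` is symmetric, respectively anti-symmetric. -/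
def HasSymmetry {d n : ℕ} (s : SymmetryType) (Y : Tensor d n) : Prop :=
  ∀ (σ : Equiv.Perm (Fin d)) (a : Fin d → Fin n), Y (fun j => a (σ j)) = s.factor σ * Y a

/-- The tangent space at `Y` of the manifold of tensors of multilinear rank `(r, …, r)`: the space
of velocities at `Y` of curves in this manifold. -/
def tangentSpace {d n : ℕ} (r : ℕ) (Y : Tensor d n) : Submodule ℂ (Tensor d n) :=
  Submodule.span ℂ {Z | ∃ γ : ℝ → Tensor d n, γ 0 = Y ∧
    (∀ᶠ s in 𝓝 0, HasMultilinearRank r (γ s)) ∧ HasDerivAt γ Z 0}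

/-- `P(Y)`, the orthogonal projection onto the tangent space at `Y`. -/
def tangentProj {d n : ℕ} (r : ℕ) (Y : Tensor d n) : Tensor d n →L[ℂ] Tensor d n :=
  (tangentSpace r Y).starProjection

/-- `M = Q R` where `Q` has orthonormal columns. Every (reduced) QR factorization is of this kind;
that `R` is triangular is not demanded. -/
def IsQR {α : Type} [Fintype α] {r : ℕ} {β : Type} (M : Matrix α β ℂ) (Q : Matrix α (Fin r) ℂ)
    (R : Matrix (Fin r) β ℂ) : Prop :=
  Qᴴ * Q = 1 ∧ M = Q * R

/-- One time step, from `t₀` to `t₁`, of the (anti-)symmetry preserving Tucker integrator for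
`Y' = F(t, Y)`: it leads from the factors of `Y₀ = C₀ ×₁ U₀ ⋯ ×_d U₀` to those of
`Y₁ = C₁ ×₁ U₁ ⋯ ×_d U₁`. (The first mode has the index `0`.) It is a relation since
QR factorizations are not unique. -/
def IsStep {d n r : ℕ} [NeZero d] (F : ℝ → Tensor d n → Tensor d n) (t₀ t₁ : ℝ)
    (C₀ : Tensor d r) (U₀ : Matrix (Fin n) (Fin r) ℂ)
    (C₁ : Tensor d r) (U₁ : Matrix (Fin n) (Fin r) ℂ) : Prop :=
  ∃ (Q₀ : Matrix (ColIdx (0 : Fin d) r) (Fin r) ℂ) (S₀ : Matrix (Fin r) (Fin r) ℂ)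
    (V₀ : Matrix (ColIdx (0 : Fin d) n) (Fin r) ℂ)
    (K : ℝ → Matrix (Fin n) (Fin r) ℂ) (R : Matrix (Fin r) (Fin r) ℂ)
    (C : ℝ → Tensor d r),
    IsQR (mat 0 C₀)ᵀ Q₀ S₀ᵀ ∧
    V₀ᵀ = Q₀ᵀ * (kronPow {j : Fin d // j ≠ 0} U₀)ᵀ ∧
    K t₀ = U₀ * S₀ ∧
    (∀ t ∈ Icc t₀ t₁, ∀ a b, HasDerivWithinAt (fun s => K s a b)
      ((mat 0 (F t (ten 0 (K t * V₀ᵀ))) * V₀.map (starRingEnd ℂ)) a b) (Icc t₀ t₁) t) ∧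
    IsQR (K t₁) U₁ R ∧
    C t₀ = tucker (tucker C₀ U₀) U₁ᴴ ∧
    (∀ t ∈ Icc t₀ t₁, HasDerivWithinAt C (tucker (F t (tucker (C t) U₁)) U₁ᴴ) (Icc t₀ t₁) t) ∧
    C₁ = C t₁

/-- `C k`, `U k`, for `k = 0, …, N`, are the factors that are produced by `N` steps with step size
`h` of the (anti-)symmetry preserving Tucker integrator, started at time `0` from a Tucker tensor
whose basis matrix has orthonormal columns. -/
def IsRun {d n r : ℕ} [NeZero d] (F : ℝ → Tensor d n → Tensor d n) (h : ℝ) (N : ℕ)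
    (C : ℕ → Tensor d r) (U : ℕ → Matrix (Fin n) (Fin r) ℂ) : Prop :=
  (U 0)ᴴ * U 0 = 1 ∧
  ∀ k < N, IsStep F (k * h) ((k + 1 : ℕ) * h) (C k) (U k) (C (k + 1)) (U (k + 1))

end SymTucker

end

/-! Consider one step of length `h = t₁ - t₀`, started from `Y₀` with error at most `e`, and put `D
= A(t₁) - A(t₀)`. With `P = U₁U₁ᴴ`, the Galerkin flow `z' = F(t, z) ×ᵢ P`, started at the projection
of `Y₀`, ends within `O(h(e + ε + h))` of the projection of `Y₀ + D` (`cStep_bound`). It remains to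
show that projecting `Y₀ + D` costs only `O(h(e + ε + h))`. Comparing with `Y₀ + D` rather than with
`A(t₁)` keeps the coefficient of `e` at `1 + O(h)`, so a discrete Gronwall argument applies. By
(anti-)symmetry, projecting in all modes costs at most `d` times as much as in the first mode
(`HasSymmetry.norm_sub_tucker_le`).

In the first mode (`norm_sub_sandwich_le_of_kStep`), set `v = V₀ᵀ`, `p = vᴴv`, `y = Ten₁(Kv)`, so
that `y' = F(t, y)p` in matricized form. Since `(I - P) y(t₁) = 0`, the defect `(I - P)(Y₀ + D)`
equals `(I - P)D(I - p)` minus `(I - P)(y(t₁) - y(t₀) - Dp)`. The second term is `O(h(e + h))` by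
the Lipschitz condition. For the first, tangent vectors at `Y` map the kernel of each matricization
into its range (`mul_deriv_mul_eq_zero`); so if `y(t₁)` has multilinear rank `(r, …, r)`, then `(I -
P)D(I - p)` is normal to the manifold there and is controlled by `ε`.

The tensor `y(t₁)` may be rank deficient. It is then a limit of tensors of full multilinear rank for
which the corresponding projections converge (`norm_sandwich_compl_le`). Inverses occur only
qualitatively in this limit, so no singular value enters the constants. -/

noncomputable section

namespace SymTucker

/-! ### Contractions and invariant subspaces -/

/-- An idempotent symmetric linear map is a contraction. -/
theorem norm_le_of_symmetric_idempotent {E : Type*} [NormedAddCommGroup E] [InnerProductSpace ℂ E]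
    (f : E → E) (hs : ∀ x y, inner ℂ (f x) y = inner ℂ x (f y)) (hi : ∀ x, f (f x) = f x) (x : E) :
    ‖f x‖ ≤ ‖x‖ := by
  have h1 : ‖f x‖ * ‖f x‖ ≤ ‖x‖ * ‖f x‖ := by
    have h2 : inner ℂ (f x) (f x) = inner ℂ x (f x) := by rw [hs, hi]
    have h3 : ‖f x‖ * ‖f x‖ = ‖inner ℂ (f x) (f x)‖ := by
      rw [inner_self_eq_norm_sq_to_K]; simp [sq]
    rw [h3, h2]
    exact norm_inner_le_norm x (f x)
  rcases (norm_nonneg (f x)).eq_or_lt with h | h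
  · rw [← h]; exact norm_nonneg x
  · exact le_of_mul_le_mul_right h1 h

/-- A subspace that is invariant under a Lipschitz vector field is invariant under its flow. -/
theorem mem_of_hasDerivWithinAt {E : Type*} [NormedAddCommGroup E] [InnerProductSpace ℂ E]
    (W : Submodule ℂ E) [W.HasOrthogonalProjection] {f : ℝ → E} {G : ℝ → E → E} {a b L : ℝ}
    (hf : ∀ t ∈ Icc a b, HasDerivWithinAt f (G t (f t)) (Icc a b) t)
    (hG : ∀ t ∈ Icc a b, ∀ x ∈ W, G t x ∈ W)
    (hL : ∀ t ∈ Icc a b, ∀ x y, ‖G t x - G t y‖ ≤ L * ‖x - y‖)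
    (ha : f a ∈ W) : ∀ t ∈ Icc a b, f t ∈ W := by
  set Q : E →L[ℂ] E := ContinuousLinearMap.id ℂ E - W.starProjection with hQ
  have hQe : ∀ x, Q x = x - W.starProjection x := fun x => rfl
  have hQW : ∀ x ∈ W, Q x = 0 := fun x hx => by
    rw [hQe, Submodule.starProjection_eq_self_iff.2 hx, sub_self]
  have hQn : ∀ x, ‖Q x‖ ≤ ‖x‖ := fun x => by
    have : Q x = Wᗮ.starProjection x := by
      rw [hQe, Submodule.starProjection_orthogonal_val]
    rw [this]; exact Submodule.norm_starProjection_apply_le _ x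
  have hd : ∀ t ∈ Icc a b, HasDerivWithinAt (fun t => Q (f t)) (Q (G t (f t))) (Icc a b) t :=
    fun t ht => (Q.restrictScalars ℝ).hasFDerivAt.comp_hasDerivWithinAt t (hf t ht)
  -- `Q` kills `G` at the projected point, which lies in `W`, so the distance to `W` satisfies a
  -- homogeneous Gronwall inequality.
  have hb : ∀ t ∈ Icc a b, ‖Q (G t (f t))‖ ≤ L * ‖Q (f t)‖ + 0 := fun t ht => by
    have h0 := hQW _ (hG t ht _ (W.starProjection_apply_mem (f t)))
    calc ‖Q (G t (f t))‖ = ‖Q (G t (f t) - G t (W.starProjection (f t)))‖ := by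
          rw [map_sub, h0, sub_zero]
      _ ≤ _ := (hQn _).trans (hL t ht _ _)
      _ = _ := by rw [add_zero, hQe]
  intro t ht
  have hlt : Ico a b ⊆ Icc a b := Ico_subset_Icc_self
  have key := norm_le_gronwallBound_of_norm_deriv_right_le (f := fun t => Q (f t)) (δ := 0)
    (fun t ht => (hd t ht).continuousWithinAt)
    (fun t ht => ((hd t (hlt ht)).mono_of_mem_nhdsWithin (Icc_mem_nhdsGE_of_mem ht)))
    (by rw [hQW _ ha, norm_zero]) (fun t ht => hb t (hlt ht)) t ht
  rw [gronwallBound_ε0_δ0] at key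
  have h0 : Q (f t) = 0 := norm_le_zero_iff.1 key
  rw [hQe, sub_eq_zero] at h0
  exact Submodule.starProjection_eq_self_iff.1 h0.symm

/-! ### Curves of matrices of bounded rank -/

theorem hasDerivAt_mul_of_continuousAt {p g : ℝ → ℂ} {p' : ℂ} (hp : HasDerivAt p p' 0)
    (hp0 : p 0 = 0) (hg : ContinuousAt g 0) : HasDerivAt (fun s => p s * g s) (p' * g 0) 0 := by
  rw [hasDerivAt_iff_tendsto_slope] at hp ⊢
  have := hp.mul (hg.tendsto.mono_left (nhdsWithin_le_nhds (s := {0}ᶜ)))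
  refine this.congr fun s => ?_
  simp [slope, hp0, mul_assoc]

/-- A matrix of rank at most `r` is recovered from `r` combinations of its rows and of its
columns with a nonsingular intersection. -/
theorem eq_mul_of_rank_le {α β ι : Type*} [Fintype α] [Fintype β] [Fintype ι]
    [DecidableEq ι] (M : Matrix α β ℂ) (hM : M.rank ≤ Fintype.card ι)
    (G : Matrix ι α ℂ) (H : Matrix β ι ℂ) (h : IsUnit (G * M * H).det) :
    M = M * H * (G * M * H)⁻¹ * (G * M) := by
  set A := G * M * H with hA
  set E := M * H * A⁻¹ with hE
  have hGE : G * E = 1 := by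
    rw [hE, ← Matrix.mul_assoc, ← Matrix.mul_assoc, ← hA, Matrix.mul_nonsing_inv _ h]
  have hle : LinearMap.range E.mulVecLin ≤ LinearMap.range M.mulVecLin := by
    rintro _ ⟨v, rfl⟩
    exact ⟨H *ᵥ (A⁻¹ *ᵥ v), by simp [hE, Matrix.mulVec_mulVec, Matrix.mul_assoc]⟩
  -- The left inverse `G` gives `E` full column rank, so its range is all of the range of `M`; on
  -- that range `E * G` is the identity.
  have hrk : M.rank ≤ E.rank := by
    calc M.rank ≤ (1 : Matrix ι ι ℂ).rank := by rwa [Matrix.rank_one]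
      _ = (G * E).rank := by rw [hGE]
      _ ≤ E.rank := Matrix.rank_mul_le_right G E
  have heq := Submodule.eq_of_le_of_finrank_le hle hrk
  classical
  apply Matrix.ext_of_mulVec_single
  intro j
  have hm : M.mulVecLin (Pi.single j 1) ∈ LinearMap.range E.mulVecLin := heq ▸ ⟨_, rfl⟩
  obtain ⟨w, hw⟩ := hm
  simp only [Matrix.mulVecLin_apply] at hw
  calc M *ᵥ Pi.single j 1 = E *ᵥ w := hw.symm
    _ = (E * (G * E)) *ᵥ w := by rw [hGE, Matrix.mul_one]
    _ = (E * G) *ᵥ (E *ᵥ w) := by simp [Matrix.mulVec_mulVec, Matrix.mul_assoc]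
    _ = (E * (G * M)) *ᵥ Pi.single j 1 := by
      rw [hw]; simp only [Matrix.mulVec_mulVec, Matrix.mul_assoc]

theorem hasDerivAt_mul_mul_apply {α β κ μ : Type*} [Fintype α] [Fintype β]
    {M : ℝ → Matrix α β ℂ} {M' : Matrix α β ℂ}
    (hd : ∀ a b, HasDerivAt (fun s => M s a b) (M' a b) 0)
    (P : Matrix κ α ℂ) (N : Matrix β μ ℂ) (i : κ) (j : μ) :
    HasDerivAt (fun s => (P * M s * N) i j) ((P * M' * N) i j) 0 := by
  simp only [Matrix.mul_apply]
  exact HasDerivAt.fun_sum fun b _ => (HasDerivAt.fun_sum fun a _ =>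
    (hd a b).const_mul (P i a)).mul_const (N b j)

/-- The velocity of a curve of matrices of rank at most `r`, at a matrix `M 0` of rank `r`, maps the
kernel of `M 0` into the range of `M 0`. -/
theorem mul_deriv_mul_eq_zero {α β κ μ ι : Type*} [Fintype α] [Fintype β] [Fintype ι]
    [DecidableEq ι] {M : ℝ → Matrix α β ℂ} {M' : Matrix α β ℂ}
    (hd : ∀ a b, HasDerivAt (fun s => M s a b) (M' a b) 0)
    (hr : ∀ᶠ s in 𝓝 0, (M s).rank ≤ Fintype.card ι)
    (G : Matrix ι α ℂ) (H : Matrix β ι ℂ) (hGH : IsUnit (G * M 0 * H).det)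
    (P : Matrix κ α ℂ) (N : Matrix β μ ℂ) (hP : P * M 0 = 0) (hN : M 0 * N = 0) :
    P * M' * N = 0 := by
  have hM : ContinuousAt M 0 :=
    continuousAt_pi.2 fun a => continuousAt_pi.2 fun b => (hd a b).continuousAt
  have hA : ContinuousAt (fun s => G * M s * H) 0 := by
    have : Continuous fun X : Matrix α β ℂ => G * X * H := by fun_prop
    exact this.continuousAt.comp hM
  have hdet : ContinuousAt (fun s => (G * M s * H).det) 0 := by
    have : Continuous fun X : Matrix ι ι ℂ => X.det := by fun_prop
    exact this.continuousAt.comp hA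
  have hinv : ContinuousAt (fun s => (G * M s * H)⁻¹) 0 := by
    simp only [Matrix.inv_def, Ring.inverse_eq_inv']
    have : Continuous fun X : Matrix ι ι ℂ => X.adjugate := Continuous.matrix_adjugate continuous_id
    exact (hdet.inv₀ hGH.ne_zero).smul (this.continuousAt.comp hA)
  have hunit : ∀ᶠ s in 𝓝 0, IsUnit (G * M s * H).det :=
    (hdet.eventually_ne hGH.ne_zero).mono fun s hs => isUnit_iff_ne_zero.2 hs
  ext i j
  have h1 := hasDerivAt_mul_mul_apply hd P N i j
  have h2 : HasDerivAt (fun s => ∑ l, ∑ k,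
      (P * M s * H) i k * ((G * M s * H)⁻¹ k l * (G * M s * N) l j))
      (∑ l, ∑ k, (P * M' * H) i k * ((G * M 0 * H)⁻¹ k l * (G * M 0 * N) l j)) 0 := by
    -- The factor `P * M s * H` vanishes at `0`, so the product rule needs only continuity of the
    -- inverse. The resulting derivative contains `G * M 0 * N`, which is zero.
    refine HasDerivAt.fun_sum fun l _ => HasDerivAt.fun_sum fun k _ => ?_
    refine hasDerivAt_mul_of_continuousAt (hasDerivAt_mul_mul_apply hd P H i k) (by simp [hP]) ?_
    refine ContinuousAt.mul ?_ (hasDerivAt_mul_mul_apply hd G N l j).continuousAt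
    exact continuousAt_pi.1 (continuousAt_pi.1 hinv k) l
  have h3 : (fun s => (P * M s * N) i j) =ᶠ[𝓝 0] fun s => ∑ l, ∑ k,
      (P * M s * H) i k * ((G * M s * H)⁻¹ k l * (G * M s * N) l j) := by
    filter_upwards [hr, hunit] with s hs hu
    have := eq_mul_of_rank_le (M s) hs G H hu
    calc (P * M s * N) i j
        = (P * (M s * H * (G * M s * H)⁻¹ * (G * M s)) * N) i j := by rw [← this]
      _ = ((P * M s * H) * (G * M s * H)⁻¹ * (G * M s * N)) i j := by
        simp only [Matrix.mul_assoc]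
      _ = _ := by
        simp only [Matrix.mul_apply (M := P * M s * H * (G * M s * H)⁻¹),
          Matrix.mul_apply (M := P * M s * H) (N := (G * M s * H)⁻¹), Finset.sum_mul, mul_assoc]
  have h4 := h1.unique (h2.congr_of_eventuallyEq h3)
  have h5 : G * M 0 * N = 0 := by rw [Matrix.mul_assoc, hN, Matrix.mul_zero]
  rw [h4, h5]
  simp

/-! ### Multilinear and Kronecker products -/

/-- The multilinear product with a matrix `W j` in each mode `j`. -/
def multiProd {d m k : ℕ} (W : Fin d → Matrix (Fin m) (Fin k) ℂ) (X : Tensor d k) : Tensor d m :=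
  WithLp.toLp 2 fun a => ∑ b : Fin d → Fin k, (∏ j, W j (a j) (b j)) * X b

/-- The Kronecker product of a family of matrices. -/
def kron {J : Type} [Fintype J] {m k : ℕ} (W : J → Matrix (Fin m) (Fin k) ℂ) :
    Matrix (J → Fin m) (J → Fin k) ℂ :=
  Matrix.of fun a b => ∏ j, W j (a j) (b j)

theorem multiProd_apply {d m k : ℕ} (W : Fin d → Matrix (Fin m) (Fin k) ℂ) (X : Tensor d k)
    (a : Fin d → Fin m) : multiProd W X a = ∑ b, (∏ j, W j (a j) (b j)) * X b := rfl

theorem tucker_eq_multiProd {d m k : ℕ} (X : Tensor d k) (U : Matrix (Fin m) (Fin k) ℂ) :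
    tucker X U = multiProd (fun _ => U) X := rfl

theorem kron_mul {J : Type} [Fintype J] [DecidableEq J] {l m k : ℕ}
    (W : J → Matrix (Fin l) (Fin m) ℂ) (W' : J → Matrix (Fin m) (Fin k) ℂ) :
    kron W * kron W' = kron fun j => W j * W' j := by
  ext a b
  simp only [kron, Matrix.mul_apply, Matrix.of_apply, ← Finset.prod_mul_distrib]
  rw [Finset.prod_univ_sum, Fintype.piFinset_univ]

theorem kron_one {J : Type} [Fintype J] [DecidableEq J] {m : ℕ} :
    kron (fun _ : J => (1 : Matrix (Fin m) (Fin m) ℂ)) = 1 := by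
  ext a b
  simp only [kron, Matrix.of_apply, Matrix.one_apply, Finset.prod_ite_zero, funext_iff]
  simp

theorem kron_conjTranspose {J : Type} [Fintype J] {m k : ℕ}
    (W : J → Matrix (Fin m) (Fin k) ℂ) : (kron W)ᴴ = kron fun j => (W j)ᴴ := by
  ext a b
  simp [kron, Matrix.conjTranspose_apply]

theorem multiProd_eq_mulVec {d m k : ℕ} (W : Fin d → Matrix (Fin m) (Fin k) ℂ) (X : Tensor d k) :
    multiProd W X = WithLp.toLp 2 (kron W *ᵥ X.ofLp) := rfl

theorem multiProd_multiProd {d l m k : ℕ} (W : Fin d → Matrix (Fin l) (Fin m) ℂ)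
    (W' : Fin d → Matrix (Fin m) (Fin k) ℂ) (X : Tensor d k) :
    multiProd W (multiProd W' X) = multiProd (fun j => W j * W' j) X := by
  simp only [multiProd_eq_mulVec, Matrix.mulVec_mulVec, kron_mul]

theorem multiProd_one {d k : ℕ} (X : Tensor d k) :
    multiProd (fun _ => (1 : Matrix (Fin k) (Fin k) ℂ)) X = X := by
  simp only [multiProd_eq_mulVec, kron_one, Matrix.one_mulVec]

theorem multiProd_add {d m k : ℕ} (W : Fin d → Matrix (Fin m) (Fin k) ℂ) (X Y : Tensor d k) :
    multiProd W (X + Y) = multiProd W X + multiProd W Y := by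
  simp only [multiProd_eq_mulVec, WithLp.ofLp_add, Matrix.mulVec_add, WithLp.toLp_add]

theorem multiProd_smul {d m k : ℕ} (W : Fin d → Matrix (Fin m) (Fin k) ℂ) (c : ℂ)
    (X : Tensor d k) : multiProd W (c • X) = c • multiProd W X := by
  simp only [multiProd_eq_mulVec, WithLp.ofLp_smul, Matrix.mulVec_smul, WithLp.toLp_smul]

/-- The multilinear product as a continuous linear map. -/
def multiProdL {d m k : ℕ} (W : Fin d → Matrix (Fin m) (Fin k) ℂ) :
    Tensor d k →L[ℂ] Tensor d m :=
  LinearMap.toContinuousLinearMap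
    { toFun := multiProd W, map_add' := multiProd_add W, map_smul' := multiProd_smul W }

theorem multiProdL_apply {d m k : ℕ} (W : Fin d → Matrix (Fin m) (Fin k) ℂ) (X : Tensor d k) :
    multiProdL W X = multiProd W X := rfl

theorem multiProd_sub {d m k : ℕ} (W : Fin d → Matrix (Fin m) (Fin k) ℂ) (X Y : Tensor d k) :
    multiProd W (X - Y) = multiProd W X - multiProd W Y :=
  (multiProdL W).map_sub X Y

theorem inner_multiProd {d m k : ℕ} (W : Fin d → Matrix (Fin m) (Fin k) ℂ) (X : Tensor d k)
    (Y : Tensor d m) :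
    inner ℂ (multiProd W X) Y = inner ℂ X (multiProd (fun j => (W j)ᴴ) Y) := by
  rw [multiProd_eq_mulVec, multiProd_eq_mulVec, ← kron_conjTranspose]
  simp only [EuclideanSpace.inner_eq_star_dotProduct, Matrix.star_mulVec]
  rw [dotProduct_comm, ← Matrix.dotProduct_mulVec, dotProduct_comm]

/-- Orthogonal projections in all modes do not increase the norm. -/
theorem norm_multiProd_le {d n : ℕ} (W : Fin d → Matrix (Fin n) (Fin n) ℂ)
    (hs : ∀ j, (W j)ᴴ = W j) (hi : ∀ j, W j * W j = W j) (X : Tensor d n) :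
    ‖multiProd W X‖ ≤ ‖X‖ :=
  norm_le_of_symmetric_idempotent (multiProd W)
    (fun X Y => by rw [inner_multiProd]; simp only [hs])
    (fun X => by rw [multiProd_multiProd]; simp only [hi]) X

/-- The matricization of a multilinear product. -/
theorem mat_multiProd {d m k : ℕ} (i : Fin d) (W : Fin d → Matrix (Fin m) (Fin k) ℂ)
    (X : Tensor d k) :
    mat i (multiProd W X) = W i * mat i X * (kron fun j : {j : Fin d // j ≠ i} => W j)ᵀ := by
  ext a c
  rw [mat, Matrix.of_apply, multiProd_apply, Matrix.mul_assoc, Matrix.mul_apply,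
    ← (Equiv.funSplitAt i (Fin k)).symm.sum_comp, Fintype.sum_prod_type]
  refine Finset.sum_congr rfl fun b _ => ?_
  rw [Matrix.mul_apply, Finset.mul_sum]
  refine Finset.sum_congr rfl fun e _ => ?_
  rw [Fintype.prod_eq_mul_prod_subtype_ne _ i]
  have : ∀ j : {j : Fin d // j ≠ i}, (j : Fin d) ≠ i := fun j => j.2
  simp [Equiv.funSplitAt, Equiv.piSplitAt, mat, kron, this]
  ring

/-! ### Two-sided multiplication of a matricization -/

theorem mat_add {d n : ℕ} (i : Fin d) (X Y : Tensor d n) : mat i (X + Y) = mat i X + mat i Y := rfl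
theorem mat_sub {d n : ℕ} (i : Fin d) (X Y : Tensor d n) : mat i (X - Y) = mat i X - mat i Y := rfl
theorem mat_smul {d n : ℕ} (i : Fin d) (c : ℂ) (X : Tensor d n) : mat i (c • X) = c • mat i X := rfl

theorem mat_injective {d n : ℕ} (i : Fin d) {X Y : Tensor d n} (h : mat i X = mat i Y) : X = Y := by
  rw [← ten_mat i X, h, ten_mat]

theorem inner_eq_trace {d n : ℕ} (i : Fin d) (X Y : Tensor d n) :
    inner ℂ X Y = ((mat i X)ᴴ * mat i Y).trace := by
  rw [Matrix.trace, PiLp.inner_apply, ← (Equiv.funSplitAt i (Fin n)).symm.sum_comp,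
    Fintype.sum_prod_type, Finset.sum_comm]
  refine Finset.sum_congr rfl fun c _ => ?_
  simp [Matrix.mul_apply, mat, mul_comm]

/-- Multiplication of the `i`th matricization from the left and from the right. -/
def sandwich {d n : ℕ} (i : Fin d) (P : Matrix (Fin n) (Fin n) ℂ)
    (N : Matrix (ColIdx i n) (ColIdx i n) ℂ) (X : Tensor d n) : Tensor d n :=
  ten i (P * mat i X * N)

theorem mat_sandwich {d n : ℕ} (i : Fin d) (P : Matrix (Fin n) (Fin n) ℂ)
    (N : Matrix (ColIdx i n) (ColIdx i n) ℂ) (X : Tensor d n) :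
    mat i (sandwich i P N X) = P * mat i X * N := mat_ten _ _

theorem sandwich_add {d n : ℕ} (i : Fin d) (P : Matrix (Fin n) (Fin n) ℂ)
    (N : Matrix (ColIdx i n) (ColIdx i n) ℂ) (X Y : Tensor d n) :
    sandwich i P N (X + Y) = sandwich i P N X + sandwich i P N Y := by
  apply mat_injective i
  simp only [mat_add, mat_sandwich, Matrix.mul_add, Matrix.add_mul]

theorem sandwich_smul {d n : ℕ} (i : Fin d) (P : Matrix (Fin n) (Fin n) ℂ)
    (N : Matrix (ColIdx i n) (ColIdx i n) ℂ) (c : ℂ) (X : Tensor d n) :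
    sandwich i P N (c • X) = c • sandwich i P N X := by
  apply mat_injective i
  simp only [mat_smul, mat_sandwich, Matrix.mul_smul, Matrix.smul_mul]

/-- `sandwich` as a continuous linear map. -/
def sandwichL {d n : ℕ} (i : Fin d) (P : Matrix (Fin n) (Fin n) ℂ)
    (N : Matrix (ColIdx i n) (ColIdx i n) ℂ) : Tensor d n →L[ℂ] Tensor d n :=
  LinearMap.toContinuousLinearMap
    { toFun := sandwich i P N, map_add' := sandwich_add i P N, map_smul' := sandwich_smul i P N }

theorem sandwichL_apply {d n : ℕ} (i : Fin d) (P : Matrix (Fin n) (Fin n) ℂ)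
    (N : Matrix (ColIdx i n) (ColIdx i n) ℂ) (X : Tensor d n) :
    sandwichL i P N X = sandwich i P N X := rfl

theorem inner_sandwich {d n : ℕ} (i : Fin d) (P : Matrix (Fin n) (Fin n) ℂ)
    (N : Matrix (ColIdx i n) (ColIdx i n) ℂ) (X Y : Tensor d n) :
    inner ℂ (sandwich i P N X) Y = inner ℂ X (sandwich i Pᴴ Nᴴ Y) := by
  rw [inner_eq_trace i, inner_eq_trace i, mat_sandwich, mat_sandwich, Matrix.conjTranspose_mul,
    Matrix.conjTranspose_mul, Matrix.mul_assoc, Matrix.trace_mul_comm]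
  simp only [Matrix.mul_assoc]

theorem sandwich_sandwich {d n : ℕ} (i : Fin d) (P P' : Matrix (Fin n) (Fin n) ℂ)
    (N N' : Matrix (ColIdx i n) (ColIdx i n) ℂ) (X : Tensor d n) :
    sandwich i P N (sandwich i P' N' X) = sandwich i (P * P') (N' * N) X := by
  apply mat_injective i
  simp only [mat_sandwich, Matrix.mul_assoc]

theorem norm_sandwich_le {d n : ℕ} (i : Fin d) {P : Matrix (Fin n) (Fin n) ℂ}
    {N : Matrix (ColIdx i n) (ColIdx i n) ℂ} (hP : Pᴴ = P) (hPP : P * P = P) (hN : Nᴴ = N)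
    (hNN : N * N = N) (X : Tensor d n) : ‖sandwich i P N X‖ ≤ ‖X‖ :=
  norm_le_of_symmetric_idempotent (sandwich i P N)
    (fun X Y => by rw [inner_sandwich, hP, hN])
    (fun X => by rw [sandwich_sandwich, hPP, hNN]) X

/-! ### Symmetry and projections in several modes -/

/-- The space of (anti-)symmetric tensors. -/
def symmetricSubmodule (d n : ℕ) (s : SymmetryType) : Submodule ℂ (Tensor d n) where
  carrier := {Y | HasSymmetry s Y}
  add_mem' := fun {X Y} hX hY σ a => by
    simp only [PiLp.add_apply, hX σ a, hY σ a, mul_add]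
  zero_mem' := fun σ a => by simp
  smul_mem' := fun c X hX σ a => by
    simp only [PiLp.smul_apply, hX σ a, smul_eq_mul]; ring

theorem SymmetryType.norm_factor {d : ℕ} (s : SymmetryType) (σ : Equiv.Perm (Fin d)) :
    ‖s.factor σ‖ = 1 := by
  cases s
  · simp [SymmetryType.factor]
  · rcases Int.units_eq_one_or (Equiv.Perm.sign σ) with h | h <;> simp [SymmetryType.factor, h]

theorem multiProd_relabel {d m k : ℕ} {s : SymmetryType} {X : Tensor d k} (hX : HasSymmetry s X)
    (W : Fin d → Matrix (Fin m) (Fin k) ℂ) (σ : Equiv.Perm (Fin d)) (a : Fin d → Fin m) :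
    multiProd W X (fun j => a (σ j)) = s.factor σ * multiProd (fun j => W (σ.symm j)) X a := by
  rw [multiProd_apply, multiProd_apply, Finset.mul_sum,
    ← (Equiv.arrowCongr σ.symm (Equiv.refl (Fin k))).sum_comp]
  refine Finset.sum_congr rfl fun b _ => ?_
  have h1 : (Equiv.arrowCongr σ.symm (Equiv.refl (Fin k))) b = fun j => b (σ j) := by
    ext j; simp [Equiv.arrowCongr]
  rw [h1, hX σ b, ← Equiv.prod_comp σ (fun j => W (σ.symm j) (a j) (b j))]
  simp only [Equiv.symm_apply_apply]
  ring

theorem HasSymmetry.tucker {d m k : ℕ} {s : SymmetryType} {X : Tensor d k} (hX : HasSymmetry s X)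
    (U : Matrix (Fin m) (Fin k) ℂ) : HasSymmetry s (tucker X U) :=
  fun σ a => multiProd_relabel hX (fun _ => U) σ a

/-- Relabelling the indices permutes the entries and multiplies `X` by a factor of modulus one, so
it carries one error into the other isometrically. -/
theorem norm_sub_multiProd_relabel {d n : ℕ} {s : SymmetryType} {X : Tensor d n}
    (hX : HasSymmetry s X) (W : Fin d → Matrix (Fin n) (Fin n) ℂ) (σ : Equiv.Perm (Fin d)) :
    ‖X - multiProd (fun j => W (σ.symm j)) X‖ = ‖X - multiProd W X‖ := by
  rw [EuclideanSpace.norm_eq, EuclideanSpace.norm_eq]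
  congr 1
  rw [← (Equiv.arrowCongr σ.symm (Equiv.refl (Fin n))).sum_comp
    (fun a => ‖(X - multiProd W X) a‖ ^ 2)]
  refine Finset.sum_congr rfl fun a _ => ?_
  have h1 : (Equiv.arrowCongr σ.symm (Equiv.refl (Fin n))) a = fun j => a (σ j) := by
    ext j; simp [Equiv.arrowCongr]
  rw [h1, PiLp.sub_apply, PiLp.sub_apply, multiProd_relabel hX W σ a, hX σ a, ← mul_sub, norm_mul,
    s.norm_factor, one_mul]

/-- The family of matrices that has `P` in the modes of `S` and the identity elsewhere. -/
def modeFamily {d n : ℕ} (S : Finset (Fin d)) (P : Matrix (Fin n) (Fin n) ℂ) (j : Fin d) :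
    Matrix (Fin n) (Fin n) ℂ := if j ∈ S then P else 1

/-- Modes are added one at a time: the new error is the old one plus the image of a single-mode
error under a contraction. -/
theorem norm_sub_multiProd_modeFamily_le {d n : ℕ} {P : Matrix (Fin n) (Fin n) ℂ} (hP : Pᴴ = P)
    (hPP : P * P = P) (X : Tensor d n) {θ : ℝ}
    (hθ : ∀ j, ‖X - multiProd (modeFamily {j} P) X‖ ≤ θ) (S : Finset (Fin d)) :
    ‖X - multiProd (modeFamily S P) X‖ ≤ S.card * θ := by
  induction S using Finset.induction_on with
  | empty =>
    have : multiProd (modeFamily ∅ P) X = X := by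
      have h0 : modeFamily (∅ : Finset (Fin d)) P = fun _ => 1 := by funext j; simp [modeFamily]
      rw [h0, multiProd_one]
    simp [this]
  | insert j S hj ih =>
    have h1 : multiProd (modeFamily (insert j S) P) X
        = multiProd (modeFamily S P) (multiProd (modeFamily {j} P) X) := by
      rw [multiProd_multiProd]
      congr 1
      ext i : 1
      by_cases hi : i = j
      · subst hi; simp [modeFamily, hj]
      · by_cases hS : i ∈ S <;> simp [modeFamily, hi, hS]
    have h2 : X - multiProd (modeFamily (insert j S) P) X
        = (X - multiProd (modeFamily S P) X)
          + multiProd (modeFamily S P) (X - multiProd (modeFamily {j} P) X) := by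
      rw [h1, multiProd_sub]; abel
    rw [h2, Finset.card_insert_of_notMem hj]
    refine (norm_add_le _ _).trans ?_
    have h3 : ‖multiProd (modeFamily S P) (X - multiProd (modeFamily {j} P) X)‖ ≤ θ := by
      refine (norm_multiProd_le _ (fun i => ?_) (fun i => ?_) _).trans (hθ j)
      · by_cases hS : i ∈ S <;> simp [modeFamily, hS, hP]
      · by_cases hS : i ∈ S <;> simp [modeFamily, hS, hPP]
    push_cast
    linarith

/-- For (anti-)symmetric tensors, the error of a projection in all modes is bounded in terms of the
error of the projection in a single mode. -/
theorem HasSymmetry.norm_sub_tucker_le {d n : ℕ} {s : SymmetryType} {X : Tensor d n}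
    (hX : HasSymmetry s X) {P : Matrix (Fin n) (Fin n) ℂ} (hP : Pᴴ = P) (hPP : P * P = P)
    (i : Fin d) : ‖X - SymTucker.tucker X P‖ ≤ d * ‖X - sandwich i P 1 X‖ := by
  have h0 : multiProd (modeFamily {i} P) X = sandwich i P 1 X := by
    apply mat_injective i
    rw [mat_multiProd, mat_sandwich]
    have : (fun j : {j : Fin d // j ≠ i} => modeFamily {i} P j) = fun _ => 1 := by
      funext j; simp [modeFamily, j.2]
    rw [this, kron_one]
    simp [modeFamily]
  have h1 : ∀ j, ‖X - multiProd (modeFamily {j} P) X‖ ≤ ‖X - sandwich i P 1 X‖ := fun j => by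
    rw [← h0, ← norm_sub_multiProd_relabel hX (modeFamily {i} P) (Equiv.swap i j)]
    apply le_of_eq
    congr 3
    funext l
    simp only [modeFamily, Finset.mem_singleton, Equiv.symm_swap]
    congr 1
    rw [Equiv.swap_apply_eq_iff, Equiv.swap_apply_left]
  have h2 := norm_sub_multiProd_modeFamily_le hP hPP X h1 Finset.univ
  have h3 : modeFamily (Finset.univ : Finset (Fin d)) P = fun _ => P := by
    funext j; simp [modeFamily]
  rwa [h3, ← tucker_eq_multiProd, Finset.card_univ, Fintype.card_fin] at h2

/-! ### Multilinear rank and its genericity -/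

theorem rank_mat_multiProd_le {d m k : ℕ} (i : Fin d) (W : Fin d → Matrix (Fin m) (Fin k) ℂ)
    (X : Tensor d k) : (mat i (multiProd W X)).rank ≤ (mat i X).rank := by
  rw [mat_multiProd]
  exact (Matrix.rank_mul_le_left _ _).trans (Matrix.rank_mul_le_right _ _)

theorem hasMultilinearRank_multiProd_iff {d m k r : ℕ} {W : Fin d → Matrix (Fin m) (Fin k) ℂ}
    {W' : Fin d → Matrix (Fin k) (Fin m) ℂ} (h : ∀ j, W' j * W j = 1) (X : Tensor d k) :
    HasMultilinearRank r (multiProd W X) ↔ HasMultilinearRank r X := by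
  refine forall_congr' fun i => ?_
  have h1 : multiProd W' (multiProd W X) = X := by
    rw [multiProd_multiProd]; simp only [h, multiProd_one]
  have h2 := rank_mat_multiProd_le i W' (multiProd W X)
  rw [h1] at h2
  rw [le_antisymm (rank_mat_multiProd_le i W X) h2]

/-- Up to the factor `H.det`, the determinant is the characteristic polynomial of `-(H⁻¹ * B)` at
`s`, which has finitely many roots. -/
theorem eventually_isUnit_det_add_smul {r : ℕ} (B H : Matrix (Fin r) (Fin r) ℂ)
    (hH : IsUnit H.det) : ∀ᶠ s : ℝ in 𝓝[≠] 0, IsUnit (B + (s : ℂ) • H).det := by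
  set p : Polynomial ℂ := (-(H⁻¹ * B)).charpoly
  have hp : p ≠ 0 := (Matrix.charpoly_monic _).ne_zero
  have h1 : ∀ s : ℝ, p.eval (s : ℂ) ≠ 0 → IsUnit (B + (s : ℂ) • H).det := fun s hs => by
    rw [isUnit_iff_ne_zero]
    have : B + (s : ℂ) • H = H * (Matrix.scalar (Fin r) (s : ℂ) - -(H⁻¹ * B)) := by
      rw [sub_neg_eq_add, mul_add, ← mul_assoc, Matrix.mul_nonsing_inv _ hH, one_mul, add_comm]
      congr 1
      rw [Matrix.scalar_apply, ← Matrix.smul_one_eq_diagonal, Matrix.mul_smul, Matrix.mul_one]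
    rw [this, Matrix.det_mul, ← Matrix.eval_charpoly]
    exact mul_ne_zero hH.ne_zero hs
  have h2 : {s : ℝ | p.eval (s : ℂ) = 0}.Finite := by
    refine Set.Finite.of_finite_image (f := fun s : ℝ => (s : ℂ)) ?_
      (Complex.ofReal_injective.injOn)
    refine (p.roots.toFinset.finite_toSet).subset ?_
    rintro _ ⟨s, hs, rfl⟩
    simpa [hp] using hs
  filter_upwards [nhdsNE_le_cofinite 0 h2.compl_mem_cofinite] with s hs
  exact h1 s hs

open scoped ComplexOrder in
/-- Tensors of full multilinear rank are dense as soon as there is one. -/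
theorem eventually_hasMultilinearRank_add_smul {d r : ℕ} (X Y : Tensor d r)
    (hY : HasMultilinearRank r Y) :
    ∀ᶠ s : ℝ in 𝓝[≠] 0, HasMultilinearRank r (X + (s : ℂ) • Y) := by
  refine eventually_all.2 fun i => ?_
  have hu : IsUnit (mat i Y * (mat i Y)ᴴ).det := by
    have hr : (mat i Y * (mat i Y)ᴴ).rank = r := by
      rw [Matrix.rank_self_mul_conjTranspose, hY i]
    have ht : LinearMap.range (mat i Y * (mat i Y)ᴴ).mulVecLin = ⊤ :=
      Submodule.eq_top_of_finrank_eq (by rw [Module.finrank_fin_fun]; exact hr)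
    rw [← Matrix.isUnit_iff_isUnit_det, ← Matrix.mulVec_surjective_iff_isUnit]
    exact LinearMap.range_eq_top.1 ht
  -- Multiplying the matricization of `X + s • Y` by `(mat i Y)ᴴ` gives a square pencil with
  -- invertible leading coefficient; its invertibility forces full row rank.
  filter_upwards [eventually_isUnit_det_add_smul (mat i X * (mat i Y)ᴴ) _ hu] with s hs
  rw [← Matrix.smul_mul, ← Matrix.add_mul, ← mat_smul, ← mat_add] at hs
  apply le_antisymm
  · simpa using Matrix.rank_le_card_height (mat i (X + (s : ℂ) • Y))
  · have h1 := Matrix.rank_of_isUnit _ ((Matrix.isUnit_iff_isUnit_det _).2 hs)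
    rw [Fintype.card_fin] at h1
    exact h1.symm.le.trans (Matrix.rank_mul_le_left _ _)

/-! ### Tangent spaces and normal components -/

/-- The tangent vectors at `Y` map the kernel of a matricization into its range. -/
theorem sandwich_eq_zero_of_mem_tangentSpace {d n r : ℕ} (i : Fin d) {Y Z : Tensor d n}
    (hZ : Z ∈ tangentSpace r Y) (G : Matrix (Fin r) (Fin n) ℂ) (H : Matrix (ColIdx i n) (Fin r) ℂ)
    (hGH : IsUnit (G * mat i Y * H).det) (P : Matrix (Fin n) (Fin n) ℂ)
    (N : Matrix (ColIdx i n) (ColIdx i n) ℂ) (hP : P * mat i Y = 0) (hN : mat i Y * N = 0) :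
    sandwich i P N Z = 0 := by
  have hle : tangentSpace r Y ≤ LinearMap.ker (sandwichL i P N).toLinearMap := by
    refine Submodule.span_le.2 ?_
    rintro Z ⟨γ, rfl, hr, hd⟩
    change sandwich i P N Z = 0
    apply mat_injective i
    rw [mat_sandwich]
    refine mul_deriv_mul_eq_zero (M := fun s => mat i (γ s)) (ι := Fin r) (fun a b => ?_)
      (hr.mono fun s hs => ?_) G H hGH P N hP hN
    · exact ((EuclideanSpace.proj (𝕜 := ℂ) ((Equiv.funSplitAt i (Fin n)).symm (a, b)) :
        Tensor d n →L[ℂ] ℂ).restrictScalars ℝ).hasFDerivAt.comp_hasDerivAt 0 hd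
    · rw [hs i, Fintype.card_fin]
  exact hle hZ

/-- The adjoint map annihilates the tangent space, so the inner product sees only the normal part of
`D`. `P` and `N` need not be orthogonal projections, which leaves room for the oblique ones used
near a singular limit. -/
theorem norm_inner_sandwich_le {d n r : ℕ} (i : Fin d) {Y : Tensor d n}
    (G : Matrix (Fin r) (Fin n) ℂ) (H : Matrix (ColIdx i n) (Fin r) ℂ)
    (hGH : IsUnit (G * mat i Y * H).det) (P : Matrix (Fin n) (Fin n) ℂ)
    (N : Matrix (ColIdx i n) (ColIdx i n) ℂ) (hP : P * mat i Y = 0) (hN : mat i Y * N = 0)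
    (X D : Tensor d n) :
    ‖inner ℂ (sandwich i Pᴴ Nᴴ X) D‖ ≤ ‖sandwich i Pᴴ Nᴴ X‖ * ‖D - tangentProj r Y D‖ := by
  have h0 : inner ℂ (sandwich i Pᴴ Nᴴ X) (tangentProj r Y D) = 0 := by
    have hm : tangentProj r Y D ∈ tangentSpace r Y := Submodule.starProjection_apply_mem _ D
    rw [inner_sandwich, Matrix.conjTranspose_conjTranspose, Matrix.conjTranspose_conjTranspose,
      sandwich_eq_zero_of_mem_tangentSpace i hm G H hGH P N hP hN, inner_zero_right]
  have h1 : inner ℂ (sandwich i Pᴴ Nᴴ X) D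
      = inner ℂ (sandwich i Pᴴ Nᴴ X) (D - tangentProj r Y D) := by
    rw [inner_sub_right, h0, sub_zero]
  rw [h1]
  exact norm_inner_le_norm _ _

theorem continuous_ten {d n : ℕ} (i : Fin d) :
    Continuous (ten i : Matrix (Fin n) (ColIdx i n) ℂ → Tensor d n) := by
  refine (PiLp.continuous_toLp 2 _).comp (continuous_pi fun x => ?_)
  exact (continuous_apply _).comp (continuous_apply _)

theorem mul_conjTranspose_self_idem {α : Type*} [Fintype α] {r : ℕ} {U : Matrix α (Fin r) ℂ}
    (hU : Uᴴ * U = 1) : (U * Uᴴ) * (U * Uᴴ) = U * Uᴴ := by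
  rw [Matrix.mul_assoc, ← Matrix.mul_assoc Uᴴ, hU, Matrix.one_mul]

theorem one_sub_idem {α : Type*} [Fintype α] [DecidableEq α] {P : Matrix α α ℂ}
    (hP : P * P = P) : (1 - P) * (1 - P) = 1 - P := by
  rw [mul_sub, mul_one, sub_mul, one_mul, hP, sub_self, sub_zero]

theorem mul_one_sub_mul_inv_mul {α : Type*} [Fintype α] [DecidableEq α] {r : ℕ}
    {w : Matrix (Fin r) α ℂ} {u : Matrix α (Fin r) ℂ} (h : IsUnit (w * u).det) :
    w * (1 - u * (w * u)⁻¹ * w) = 0 := by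
  rw [Matrix.mul_sub, Matrix.mul_one, ← Matrix.mul_assoc, ← Matrix.mul_assoc,
    Matrix.mul_nonsing_inv _ h, Matrix.one_mul, sub_self]

theorem continuousAt_one_sub_mul_inv_mul {α : Type*} [Fintype α] [DecidableEq α] {r : ℕ}
    {w : ℝ → Matrix (Fin r) α ℂ} (hw : Continuous w) {u : Matrix α (Fin r) ℂ} (h : w 0 * u = 1) :
    ContinuousAt (fun s => 1 - u * (w s * u)⁻¹ * w s) 0 := by
  have h1 : ContinuousAt (fun s => (w s * u)⁻¹) 0 := by
    have h2 : ContinuousAt (fun M : Matrix (Fin r) (Fin r) ℂ => M⁻¹) (w 0 * u) := by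
      refine continuousAt_matrix_inv _ ?_
      rw [h, Matrix.det_one]
      simp only [Ring.inverse_eq_inv']
      exact continuousAt_inv₀ one_ne_zero
    exact ContinuousAt.comp (f := fun s => w s * u) h2 (by fun_prop)
  have h3 : Continuous fun p : Matrix (Fin r) (Fin r) ℂ × Matrix (Fin r) α ℂ =>
      1 - u * p.1 * p.2 := by fun_prop
  exact ContinuousAt.comp (f := fun s => ((w s * u)⁻¹, w s)) h3.continuousAt
    (h1.prodMk hw.continuousAt)

/-- The tensor is the multilinear product of `C` with `K` in the first mode and `U₀` in the others,
all of which have left inverses. -/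
theorem hasMultilinearRank_ten {d n r : ℕ} [NeZero d] {U₀ K : Matrix (Fin n) (Fin r) ℂ}
    {K' : Matrix (Fin r) (Fin n) ℂ} (hU₀ : U₀ᴴ * U₀ = 1) (hK : K' * K = 1) {C : Tensor d r}
    (hC : HasMultilinearRank r C) :
    HasMultilinearRank r
      (ten 0 (K * (mat 0 C * (kron fun _ : {j : Fin d // j ≠ 0} => U₀)ᵀ))) := by
  have h : ten 0 (K * (mat 0 C * (kron fun _ : {j : Fin d // j ≠ 0} => U₀)ᵀ)) = multiProd
      (fun j => if j = 0 then K else U₀) C := by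
    apply mat_injective 0
    rw [mat_ten, mat_multiProd]
    have h1 : (fun j : {j : Fin d // j ≠ 0} => if (j : Fin d) = 0 then K else U₀)
        = fun _ => U₀ := by
      funext j; simp [j.2]
    rw [h1, if_pos rfl, Matrix.mul_assoc]
  rw [h, hasMultilinearRank_multiProd_iff (W' := fun j => if j = 0 then K' else U₀ᴴ)]
  · exact hC
  · intro j
    by_cases hj : j = 0
    · simp only [hj, if_true, hK]
    · simp only [hj, if_false, hU₀]

/-- For an orthogonal projection `Π`, the inner product of `Π D` with `D` is `‖Π D‖²`; one factor
cancels. -/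
theorem norm_le_of_inner_sandwich_le {d n : ℕ} (i : Fin d) {P : Matrix (Fin n) (Fin n) ℂ}
    {N : Matrix (ColIdx i n) (ColIdx i n) ℂ} (hP : Pᴴ = P) (hPP : P * P = P) (hN : Nᴴ = N)
    (hNN : N * N = N) (D : Tensor d n) {κ : ℝ} (hκ : 0 ≤ κ)
    (h : ‖inner ℂ (sandwich i P N D) D‖ ≤ ‖sandwich i P N D‖ * κ) :
    ‖sandwich i P N D‖ ≤ κ := by
  have h1 : inner ℂ (sandwich i P N D) D = inner ℂ (sandwich i P N D) (sandwich i P N D) := by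
    conv_rhs => rw [← hP, ← hN, ← inner_sandwich, hP, hN, sandwich_sandwich, hPP, hNN]
  rw [h1, inner_self_eq_norm_sq_to_K] at h
  have h2 : ‖sandwich i P N D‖ * ‖sandwich i P N D‖ ≤ ‖sandwich i P N D‖ * κ := by
    simpa [sq] using h
  rcases (norm_nonneg (sandwich i P N D)).eq_or_lt with h3 | h3
  · rw [← h3]; exact hκ
  · exact le_of_mul_le_mul_left h2 h3

/-- Let `U * R * v` be the first matricization of a limit of tensors of multilinear rank
`(r, …, r)` where the part of `D` that is normal to the tangent space has norm at most `κ`. Then the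
part of `D` outside the range of `U` and the row space of `v` has norm at most `κ`, no matter how
close to singular `R` is. -/
theorem norm_sandwich_compl_le {d n r : ℕ} [NeZero d] {U₀ U₁ : Matrix (Fin n) (Fin r) ℂ}
    (hU₀ : U₀ᴴ * U₀ = 1) (hU₁ : U₁ᴴ * U₁ = 1) (q : Matrix (Fin r) (ColIdx (0 : Fin d) r) ℂ)
    {v : Matrix (Fin r) (ColIdx (0 : Fin d) n) ℂ} (hv : v * vᴴ = 1)
    (hq : v = q * (kron fun _ : {j : Fin d // j ≠ 0} => U₀)ᵀ) (R : Matrix (Fin r) (Fin r) ℂ)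
    {C : Tensor d r} (hC : HasMultilinearRank r C) (D : Tensor d n) {κ η : ℝ} (hκ : 0 ≤ κ)
    (hη : 0 < η) (hD : ∀ Y, HasMultilinearRank r Y → ‖Y - ten 0 (U₁ * R * v)‖ < η →
      ‖D - tangentProj r Y D‖ ≤ κ) :
    ‖sandwich 0 (1 - U₁ * U₁ᴴ) (1 - vᴴ * v) D‖ ≤ κ := by
  have hPs : (1 - U₁ * U₁ᴴ)ᴴ = 1 - U₁ * U₁ᴴ := by simp
  have hPP := one_sub_idem (mul_conjTranspose_self_idem hU₁)
  have hPU : (1 - U₁ * U₁ᴴ) * U₁ = 0 := by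
    rw [Matrix.sub_mul, Matrix.mul_assoc, hU₁, Matrix.one_mul, Matrix.mul_one, sub_self]
  have hNs : (1 - vᴴ * v)ᴴ = 1 - vᴴ * v := by simp
  have hNN : (1 - vᴴ * v) * (1 - vᴴ * v) = 1 - vᴴ * v := one_sub_idem (by
    rw [Matrix.mul_assoc, ← Matrix.mul_assoc v, hv, Matrix.one_mul])
  refine norm_le_of_inner_sandwich_le 0 hPs hPP hNs hNN D hκ ?_
  obtain ⟨X, hX⟩ : ∃ X, X = sandwich 0 (1 - U₁ * U₁ᴴ) (1 - vᴴ * v) D := ⟨_, rfl⟩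
  have hXX : sandwich 0 (1 - U₁ * U₁ᴴ) (1 - vᴴ * v) X = X := by
    rw [hX, sandwich_sandwich, hPP, hNN]
  rw [← hX]
  obtain ⟨P, hP⟩ : ∃ P, P = 1 - U₁ * U₁ᴴ := ⟨_, rfl⟩
  rw [← hP] at hPs hPU hXX
  -- Both possible degeneracies are perturbed: `v` through its core `q`, in the direction of the
  -- full-rank core `C`, and `R` by `s • 1`. The range of `U₁` still contains all columns.
  let w : ℝ → Matrix (Fin r) (ColIdx (0 : Fin d) n) ℂ := fun s =>
    mat 0 (ten 0 q + (s : ℂ) • C) * (kron fun _ : {j : Fin d // j ≠ 0} => U₀)ᵀ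
  have hw0 : w 0 = v := by simp [w, hq, mat_ten]
  have hwc : Continuous w := by
    simp only [w, mat_add, mat_smul]; fun_prop
  have hYc : Continuous fun s : ℝ => (ten 0 (U₁ * (R + (s : ℂ) • 1) * w s) : Tensor d n) :=
    (continuous_ten 0).comp (by fun_prop)
  have hAc : Continuous fun s => w s * vᴴ := by fun_prop
  have hA0 : w 0 * vᴴ = 1 := by rw [hw0, hv]
  -- Where `w s * vᴴ` is invertible, this is the oblique projection onto the kernel of `w s` along
  -- the range of `vᴴ`; it tends to the orthogonal projection `1 - vᴴ * v`.
  let N : ℝ → Matrix (ColIdx (0 : Fin d) n) (ColIdx (0 : Fin d) n) ℂ := fun s =>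
    1 - vᴴ * (w s * vᴴ)⁻¹ * w s
  have hN0 : N 0 = 1 - vᴴ * v := by simp [N, hw0, hv]
  have hNc : ContinuousAt N 0 := continuousAt_one_sub_mul_inv_mul hwc hA0
  have hXt : Tendsto (fun s => sandwich 0 Pᴴ (N s)ᴴ X) (𝓝[≠] 0) (𝓝 X) := by
    have h2 : Continuous fun M : Matrix (ColIdx (0 : Fin d) n) (ColIdx (0 : Fin d) n) ℂ =>
        sandwich 0 Pᴴ Mᴴ X := (continuous_ten 0).comp (by fun_prop)
    have h4 := (ContinuousAt.comp (f := N) h2.continuousAt hNc).tendsto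
    simp only [Function.comp_def, hN0, hPs, hNs, hXX] at h4
    rw [hPs]
    exact h4.mono_left nhdsWithin_le_nhds
  have hunit : ∀ᶠ s : ℝ in 𝓝[≠] 0, IsUnit (w s * vᴴ).det := by
    have h1 : ContinuousAt (fun s => (w s * vᴴ).det) 0 :=
      (Continuous.matrix_det hAc).continuousAt
    have h2 : (w 0 * vᴴ).det ≠ 0 := by rw [hA0, Matrix.det_one]; exact one_ne_zero
    exact nhdsWithin_le_nhds ((h1.eventually_ne h2).mono fun s hs => isUnit_iff_ne_zero.2 hs)
  have hnear : ∀ᶠ s : ℝ in 𝓝[≠] 0,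
      ‖ten 0 (U₁ * (R + (s : ℂ) • 1) * w s) - ten 0 (U₁ * R * v)‖ < η := by
    have h1 := (hYc.sub (continuous_const (y := ten 0 (U₁ * R * v)))).norm.continuousAt (x := 0)
    refine nhdsWithin_le_nhds (h1.eventually_lt continuousAt_const ?_)
    simpa [hw0] using hη
  have hev : ∀ᶠ s : ℝ in 𝓝[≠] 0,
      ‖inner ℂ (sandwich 0 Pᴴ (N s)ᴴ X) D‖ ≤ ‖sandwich 0 Pᴴ (N s)ᴴ X‖ * κ := by
    filter_upwards [hunit, hnear, eventually_hasMultilinearRank_add_smul (ten 0 q) C hC,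
      eventually_isUnit_det_add_smul R 1 (by simp)] with s hs hn hCs hR
    have hleft : ((R + (s : ℂ) • 1)⁻¹ * U₁ᴴ) * (U₁ * (R + (s : ℂ) • 1)) = 1 := by
      rw [Matrix.mul_assoc, ← Matrix.mul_assoc U₁ᴴ, hU₁, Matrix.one_mul,
        Matrix.nonsing_inv_mul _ hR]
    have hrank : HasMultilinearRank r (ten 0 (U₁ * (R + (s : ℂ) • 1) * w s)) :=
      hasMultilinearRank_ten hU₀ hleft hCs
    refine (norm_inner_sandwich_le (r := r) 0 ((R + (s : ℂ) • 1)⁻¹ * U₁ᴴ) vᴴ ?_ P (N s)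
      ?_ ?_ X D).trans (mul_le_mul_of_nonneg_left (hD _ hrank hn) (norm_nonneg _))
    · rw [mat_ten, ← Matrix.mul_assoc, hleft, Matrix.one_mul]
      exact hs
    · rw [mat_ten, Matrix.mul_assoc U₁, ← Matrix.mul_assoc P, hPU, Matrix.zero_mul]
    · have h1 : w s * N s = 0 := mul_one_sub_mul_inv_mul hs
      rw [mat_ten, Matrix.mul_assoc, h1, Matrix.mul_zero]
  exact le_of_tendsto_of_tendsto (hXt.inner tendsto_const_nhds).norm (hXt.norm.mul_const κ) hev

/-! ### The K-step -/

theorem hasDerivWithinAt_ten_mul {d n r : ℕ} (i : Fin d) {K : ℝ → Matrix (Fin n) (Fin r) ℂ}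
    {K' : Matrix (Fin n) (Fin r) ℂ} {S : Set ℝ} {t : ℝ}
    (hK : ∀ a b, HasDerivWithinAt (fun s => K s a b) (K' a b) S t)
    (v : Matrix (Fin r) (ColIdx i n) ℂ) :
    HasDerivWithinAt (fun s => ten i (K s * v)) (ten i (K' * v)) S t := by
  have h : HasDerivWithinAt (fun s => (ten i (K s * v)).ofLp) (ten i (K' * v)).ofLp S t := by
    refine hasDerivWithinAt_pi.2 fun x => ?_
    simp only [ten, Matrix.mul_apply]
    exact HasDerivWithinAt.fun_sum fun b _ => (hK _ b).mul_const _
  exact ((PiLp.continuousLinearEquiv 2 ℝ (fun _ : Fin d → Fin n => ℂ)).symm :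
    _ →L[ℝ] Tensor d n).hasFDerivAt.comp_hasDerivWithinAt t h

theorem norm_sub_le_of_hasDerivWithinAt {E : Type*} [NormedAddCommGroup E] [NormedSpace ℝ E]
    {f f' : ℝ → E} {a b c : ℝ} (hf : ∀ t ∈ Icc a b, HasDerivWithinAt f (f' t) (Icc a b) t)
    (hc : ∀ t ∈ Icc a b, ‖f' t‖ ≤ c) (hc0 : 0 ≤ c) {t : ℝ} (ht : t ∈ Icc a b) :
    ‖f t - f a‖ ≤ c * (b - a) := by
  refine (norm_image_sub_le_of_norm_deriv_le_segment' hf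
    (fun t ht => hc t (Ico_subset_Icc_self ht)) t ht).trans ?_
  exact mul_le_mul_of_nonneg_left (by linarith [ht.2]) hc0

theorem mul_conjTranspose_kron_eq_one {d n r : ℕ} {i : Fin d} {U : Matrix (Fin n) (Fin r) ℂ}
    (hU : Uᴴ * U = 1) {Q : Matrix (ColIdx i r) (Fin r) ℂ} (hQ : Qᴴ * Q = 1) :
    (Qᵀ * (kron fun _ : {j : Fin d // j ≠ i} => U)ᵀ)
      * (Qᵀ * (kron fun _ : {j : Fin d // j ≠ i} => U)ᵀ)ᴴ = 1 := by
  set k := kron fun _ : {j : Fin d // j ≠ i} => U with hk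
  have h1 : kᴴ * k = 1 := by
    rw [hk, kron_conjTranspose, kron_mul]; simp only [hU, kron_one]
  have h2 : (k * Q)ᴴ * (k * Q) = 1 := by
    rw [Matrix.conjTranspose_mul, Matrix.mul_assoc, ← Matrix.mul_assoc kᴴ, h1, Matrix.one_mul, hQ]
  rw [← Matrix.transpose_mul]
  have h3 := congrArg Matrix.transpose h2
  rw [Matrix.transpose_mul, Matrix.transpose_one] at h3
  exact h3

/-- The range of the new basis matrix contains the first matricization of the solution increment up
to a small error, independently of singular values. -/
theorem norm_sub_sandwich_le_of_kStep {d n r : ℕ} [NeZero d] {F : ℝ → Tensor d n → Tensor d n}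
    {A : ℝ → Tensor d n} {t₀ t₁ L B ε ρ e : ℝ} (ht : t₀ < t₁) (hL0 : 0 ≤ L) (hB0 : 0 ≤ B)
    (hε0 : 0 ≤ ε)
    (hA : ∀ t ∈ Icc t₀ t₁, HasDerivWithinAt A (F t (A t)) (Icc t₀ t₁) t)
    (hL : ∀ t ∈ Icc t₀ t₁, ∀ Y Z, ‖F t Y - F t Z‖ ≤ L * ‖Y - Z‖)
    (hB : ∀ t ∈ Icc t₀ t₁, ∀ Y, ‖F t Y‖ ≤ B)
    (hε : ∀ t ∈ Icc t₀ t₁, ∀ Y, HasMultilinearRank r Y → ‖Y - A t‖ < ρ →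
      ‖F t Y - tangentProj r Y (F t Y)‖ ≤ ε)
    {C C₀ : Tensor d r} (hC : HasMultilinearRank r C) {U₀ U₁ : Matrix (Fin n) (Fin r) ℂ}
    (hU₀ : U₀ᴴ * U₀ = 1) (he : ‖tucker C₀ U₀ - A t₀‖ ≤ e)
    (hρ : e + (2 * B + 1) * (t₁ - t₀) ≤ ρ)
    {Q : Matrix (ColIdx (0 : Fin d) r) (Fin r) ℂ} {S : Matrix (Fin r) (Fin r) ℂ}
    {v : Matrix (Fin r) (ColIdx (0 : Fin d) n) ℂ} {K : ℝ → Matrix (Fin n) (Fin r) ℂ}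
    {R : Matrix (Fin r) (Fin r) ℂ} (hQ : IsQR (mat 0 C₀)ᵀ Q Sᵀ)
    (hv : v = Qᵀ * (kron fun _ : {j : Fin d // j ≠ 0} => U₀)ᵀ) (hK₀ : K t₀ = U₀ * S)
    (hK : ∀ t ∈ Icc t₀ t₁, ∀ a b, HasDerivWithinAt (fun s => K s a b)
      ((mat 0 (F t (ten 0 (K t * v))) * vᴴ) a b) (Icc t₀ t₁) t)
    (hU₁ : IsQR (K t₁) U₁ R) :
    ‖(tucker C₀ U₀ + (A t₁ - A t₀)) - sandwich 0 (U₁ * U₁ᴴ) 1 (tucker C₀ U₀ + (A t₁ - A t₀))‖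
      ≤ (t₁ - t₀) * (ε + 2 * L * (e + (2 * B + 1) * (t₁ - t₀))) := by
  obtain ⟨hQQ, hQS⟩ := hQ
  obtain ⟨hUU, hKU⟩ := hU₁
  have hh : 0 < t₁ - t₀ := sub_pos.2 ht
  have he0 : 0 ≤ e := (norm_nonneg _).trans he
  have hm0 : t₀ ∈ Icc t₀ t₁ := ⟨le_rfl, ht.le⟩
  have hm1 : t₁ ∈ Icc t₀ t₁ := ⟨ht.le, le_rfl⟩
  have hvv : v * vᴴ = 1 := by rw [hv]; exact mul_conjTranspose_kron_eq_one hU₀ hQQ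
  have hpp : (vᴴ * v) * (vᴴ * v) = vᴴ * v := by
    rw [Matrix.mul_assoc, ← Matrix.mul_assoc v, hvv, Matrix.one_mul]
  have hps : (vᴴ * v)ᴴ = vᴴ * v := by simp
  have hproj : ∀ X : Tensor d n, ‖sandwich 0 1 (vᴴ * v) X‖ ≤ ‖X‖ := fun X =>
    norm_sandwich_le 0 (by simp) (by simp) hps hpp X
  obtain ⟨y, hy⟩ : ∃ y : ℝ → Tensor d n, y = fun t => ten 0 (K t * v) := ⟨_, rfl⟩
  have hy₀ : y t₀ = tucker C₀ U₀ := by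
    apply mat_injective 0
    have h1 : mat 0 C₀ = S * Qᵀ := by
      rw [← Matrix.transpose_transpose (mat 0 C₀), hQS, Matrix.transpose_mul,
        Matrix.transpose_transpose]
    simp only [hy]
    rw [mat_ten, tucker_eq_multiProd, mat_multiProd, h1, hK₀, hv]
    simp only [Matrix.mul_assoc]
  have hy₁ : y t₁ = ten 0 (U₁ * R * v) := by simp only [hy]; rw [hKU]
  have hyd : ∀ t ∈ Icc t₀ t₁, HasDerivWithinAt y (sandwich 0 1 (vᴴ * v) (F t (y t)))
      (Icc t₀ t₁) t := fun t ht => by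
    have h1 := hasDerivWithinAt_ten_mul 0 (hK t ht) v
    have h2 : sandwich 0 1 (vᴴ * v) (F t (y t))
        = ten 0 (mat 0 (F t (ten 0 (K t * v))) * vᴴ * v) := by
      rw [sandwich, hy, Matrix.one_mul, Matrix.mul_assoc]
    rw [h2, hy]
    exact h1
  have hyb : ∀ t ∈ Icc t₀ t₁, ‖y t - y t₀‖ ≤ B * (t₁ - t₀) := fun t ht =>
    norm_sub_le_of_hasDerivWithinAt hyd (fun t ht => (hproj _).trans (hB t ht _)) hB0 ht
  have hAb : ∀ t ∈ Icc t₀ t₁, ‖A t - A t₀‖ ≤ B * (t₁ - t₀) := fun t ht =>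
    norm_sub_le_of_hasDerivWithinAt hA (fun t ht => hB t ht _) hB0 ht
  have hyA : ∀ t ∈ Icc t₀ t₁, ∀ t' ∈ Icc t₀ t₁, ‖y t - A t'‖ ≤ e + 2 * B * (t₁ - t₀) :=
    fun t ht t' ht' => by
      have h1 : y t - A t' = (y t - y t₀) + (tucker C₀ U₀ - A t₀) - (A t' - A t₀) := by
        rw [hy₀]; abel
      rw [h1]
      have h2 := norm_sub_le ((y t - y t₀) + (tucker C₀ U₀ - A t₀)) (A t' - A t₀)
      have h3 := norm_add_le (y t - y t₀) (tucker C₀ U₀ - A t₀)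
      linarith [hyb t ht, hAb t' ht']
  obtain ⟨D, hD⟩ : ∃ D, D = A t₁ - A t₀ := ⟨_, rfl⟩
  have hcons : ‖(y t₁ - y t₀) - sandwich 0 1 (vᴴ * v) D‖
      ≤ L * (e + 2 * B * (t₁ - t₀)) * (t₁ - t₀) := by
    have hd : ∀ t ∈ Icc t₀ t₁, HasDerivWithinAt (fun t => y t - sandwichL 0 1 (vᴴ * v) (A t))
        (sandwich 0 1 (vᴴ * v) (F t (y t)) - sandwichL 0 1 (vᴴ * v) (F t (A t)))
        (Icc t₀ t₁) t := fun t ht =>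
      (hyd t ht).sub (((sandwichL 0 1 (vᴴ * v)).restrictScalars ℝ).hasFDerivAt.comp_hasDerivWithinAt
        t (hA t ht))
    have h1 := norm_sub_le_of_hasDerivWithinAt (c := L * (e + 2 * B * (t₁ - t₀))) hd
      (fun t ht => by
        rw [← sandwichL_apply, ← map_sub, sandwichL_apply]
        exact (hproj _).trans ((hL t ht _ _).trans
          (mul_le_mul_of_nonneg_left (hyA t ht t ht) hL0))) (by positivity) hm1
    have h2 : (y t₁ - y t₀) - sandwich 0 1 (vᴴ * v) D
        = (y t₁ - sandwichL 0 1 (vᴴ * v) (A t₁)) - (y t₀ - sandwichL 0 1 (vᴴ * v) (A t₀)) := by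
      rw [hD, ← sandwichL_apply, map_sub]; abel
    rw [h2]
    exact h1
  have hnormal : ‖sandwich 0 (1 - U₁ * U₁ᴴ) (1 - vᴴ * v) D‖
      ≤ (ε + L * (e + (2 * B + 1) * (t₁ - t₀))) * (t₁ - t₀) := by
    -- The perturbation radius is taken to be `t₁ - t₀`: it accounts for the `+ 1` in `2 * B + 1`
    -- and keeps `Y` in the `ρ`-neighbourhood of every `A t`. The normal projection at the fixed `Y`
    -- can then be integrated along `A`.
    refine norm_sandwich_compl_le hU₀ hUU Qᵀ hvv hv R hC D (by positivity) hh
      fun Y hY hYy => ?_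
    have hYA : ∀ t ∈ Icc t₀ t₁, ‖Y - A t‖ < e + (2 * B + 1) * (t₁ - t₀) := fun t ht => by
      have h1 : Y - A t = (Y - y t₁) + (y t₁ - A t) := by abel
      rw [← hy₁] at hYy
      rw [h1]
      have h2 := norm_add_le (Y - y t₁) (y t₁ - A t)
      linarith [hyA t₁ hm1 t ht]
    set q : Tensor d n →L[ℂ] Tensor d n := ContinuousLinearMap.id ℂ _ - tangentProj r Y with hq
    have hqe : ∀ X, q X = X - tangentProj r Y X := fun X => rfl
    have hqn : ∀ X, ‖q X‖ ≤ ‖X‖ := fun X => by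
      have : q X = (tangentSpace r Y)ᗮ.starProjection X := by
        rw [hqe, Submodule.starProjection_orthogonal_val]; rfl
      rw [this]; exact Submodule.norm_starProjection_apply_le _ X
    have hd : ∀ t ∈ Icc t₀ t₁, HasDerivWithinAt (fun t => q (A t)) (q (F t (A t)))
        (Icc t₀ t₁) t := fun t ht =>
      (q.restrictScalars ℝ).hasFDerivAt.comp_hasDerivWithinAt t (hA t ht)
    have h1 := norm_sub_le_of_hasDerivWithinAt (c := ε + L * (e + (2 * B + 1) * (t₁ - t₀))) hd
      (fun t ht => by
        have h2 : q (F t (A t)) = q (F t Y) - q (F t Y - F t (A t)) := by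
          rw [map_sub]; abel
        rw [h2]
        refine (norm_sub_le _ _).trans (add_le_add ?_ ?_)
        · exact hε t ht Y hY ((hYA t ht).trans_le hρ)
        · exact (hqn _).trans ((hL t ht _ _).trans
            (mul_le_mul_of_nonneg_left (hYA t ht).le hL0))) (by positivity) hm1
    rwa [← map_sub, ← hD, hqe] at h1
  rw [← hD, ← hy₀]
  obtain ⟨P, hP⟩ : ∃ P, P = 1 - U₁ * U₁ᴴ := ⟨_, rfl⟩
  have hPs : Pᴴ = P := by simp [hP]
  have hPP : P * P = P := by rw [hP]; exact one_sub_idem (mul_conjTranspose_self_idem hUU)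
  have hPU : P * U₁ = 0 := by
    rw [hP, Matrix.sub_mul, Matrix.mul_assoc, hUU, Matrix.one_mul, Matrix.mul_one, sub_self]
  have hsplit : (y t₀ + D) - sandwich 0 (U₁ * U₁ᴴ) 1 (y t₀ + D)
      = sandwich 0 P (1 - vᴴ * v) D
        - sandwich 0 P 1 ((y t₁ - y t₀) - sandwich 0 1 (vᴴ * v) D) := by
    have h1 : P * mat 0 (y t₁) = 0 := by
      rw [hy₁, mat_ten, Matrix.mul_assoc, ← Matrix.mul_assoc P, hPU, Matrix.zero_mul]
    apply mat_injective 0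
    have h2 : mat 0 (y t₀ + D) - U₁ * U₁ᴴ * mat 0 (y t₀ + D) = P * mat 0 (y t₀ + D) := by
      rw [hP, Matrix.sub_mul, Matrix.one_mul]
    simp only [mat_sub, mat_sandwich, Matrix.mul_one, Matrix.one_mul]
    rw [h2, mat_add]
    simp only [Matrix.mul_add, Matrix.mul_sub, h1, Matrix.mul_one]
    rw [← Matrix.mul_assoc P]
    abel
  rw [hsplit]
  have h1 : ‖sandwich 0 P 1 ((y t₁ - y t₀) - sandwich 0 1 (vᴴ * v) D)‖
      ≤ L * (e + 2 * B * (t₁ - t₀)) * (t₁ - t₀) :=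
    (norm_sandwich_le 0 hPs hPP (by simp) (by simp) _).trans hcons
  rw [← hP] at hnormal
  refine (norm_sub_le _ _).trans ((add_le_add hnormal h1).trans ?_)
  nlinarith [mul_nonneg hL0 (mul_nonneg hh.le hh.le)]

/-! ### The Galerkin step for the core -/

theorem tucker_tucker {d l m k : ℕ} (X : Tensor d k) (U : Matrix (Fin m) (Fin k) ℂ)
    (U' : Matrix (Fin l) (Fin m) ℂ) : tucker (tucker X U) U' = tucker X (U' * U) := by
  simp only [tucker_eq_multiProd, multiProd_multiProd]

/-- The Galerkin step preserves the structure, and its error is bounded by the projection error of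
the increment. -/
theorem cStep_bound {d n r : ℕ} {s : SymmetryType} {F : ℝ → Tensor d n → Tensor d n}
    {A : ℝ → Tensor d n} {t₀ t₁ L B e θ : ℝ} (ht : t₀ < t₁) (hL0 : 0 ≤ L) (hB0 : 0 ≤ B)
    (hA : ∀ t ∈ Icc t₀ t₁, HasDerivWithinAt A (F t (A t)) (Icc t₀ t₁) t)
    (hF : ∀ t ∈ Icc t₀ t₁, ∀ Y, HasSymmetry s Y → HasSymmetry s (F t Y))
    (hL : ∀ t ∈ Icc t₀ t₁, ∀ Y Z, ‖F t Y - F t Z‖ ≤ L * ‖Y - Z‖)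
    (hB : ∀ t ∈ Icc t₀ t₁, ∀ Y, ‖F t Y‖ ≤ B)
    {Y₀ : Tensor d n} (hY₀ : HasSymmetry s Y₀) (he : ‖Y₀ - A t₀‖ ≤ e)
    {U : Matrix (Fin n) (Fin r) ℂ} (hU : Uᴴ * U = 1)
    (hθ : ‖(Y₀ + (A t₁ - A t₀)) - tucker (Y₀ + (A t₁ - A t₀)) (U * Uᴴ)‖ ≤ θ)
    {C : ℝ → Tensor d r} (hC₀ : C t₀ = tucker Y₀ Uᴴ)
    (hC : ∀ t ∈ Icc t₀ t₁,
      HasDerivWithinAt C (tucker (F t (tucker (C t) U)) Uᴴ) (Icc t₀ t₁) t) :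
    HasSymmetry s (tucker (C t₁) U) ∧
      ‖tucker (C t₁) U - A t₁‖ ≤ e + θ + (t₁ - t₀) * (L * (e + 4 * B * (t₁ - t₀) + θ)) := by
  have hh : 0 < t₁ - t₀ := sub_pos.2 ht
  have he0 : 0 ≤ e := (norm_nonneg _).trans he
  have hθ0 : 0 ≤ θ := (norm_nonneg _).trans hθ
  have hm1 : t₁ ∈ Icc t₀ t₁ := ⟨ht.le, le_rfl⟩
  obtain ⟨P, hP⟩ : ∃ P, P = U * Uᴴ := ⟨_, rfl⟩
  have hPn : ∀ X : Tensor d n, ‖tucker X P‖ ≤ ‖X‖ := fun X =>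
    norm_multiProd_le (fun _ => P) (fun _ => by simp [hP])
      (fun _ => by rw [hP]; exact mul_conjTranspose_self_idem hU) X
  obtain ⟨z, hz⟩ : ∃ z : ℝ → Tensor d n, z = fun t => tucker (C t) U := ⟨_, rfl⟩
  have hz₀ : z t₀ = tucker Y₀ P := by simp only [hz]; rw [hC₀, tucker_tucker, hP]
  have hzd : ∀ t ∈ Icc t₀ t₁, HasDerivWithinAt z (tucker (F t (z t)) P) (Icc t₀ t₁) t :=
    fun t ht => by
      have h1 := ((multiProdL (d := d) fun _ => U).restrictScalars
        ℝ).hasFDerivAt.comp_hasDerivWithinAt t (hC t ht)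
      have h2 : tucker (F t (z t)) P = tucker (tucker (F t (tucker (C t) U)) Uᴴ) U := by
        rw [tucker_tucker, hP, hz]
      rw [h2, hz]
      exact h1
  have hsub : ∀ X Y : Tensor d n, tucker X P - tucker Y P = tucker (X - Y) P := fun X Y =>
    (multiProd_sub (fun _ => P) X Y).symm
  have hsym := mem_of_hasDerivWithinAt (symmetricSubmodule d n s)
    (G := fun t Y => tucker (F t Y) P) hzd
    (fun t ht Y hY => (hF t ht Y hY).tucker P)
    (fun t ht X Y => by rw [hsub]; exact (hPn _).trans (hL t ht X Y))
    (by rw [hz₀]; exact hY₀.tucker P) t₁ hm1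
  have hzb : ∀ t ∈ Icc t₀ t₁, ‖z t - z t₀‖ ≤ B * (t₁ - t₀) := fun t ht =>
    norm_sub_le_of_hasDerivWithinAt hzd (fun t ht => (hPn _).trans (hB t ht _)) hB0 ht
  have hAb : ∀ t ∈ Icc t₀ t₁, ‖A t - A t₀‖ ≤ B * (t₁ - t₀) := fun t ht =>
    norm_sub_le_of_hasDerivWithinAt hA (fun t ht => hB t ht _) hB0 ht
  obtain ⟨D, hD⟩ : ∃ D, D = A t₁ - A t₀ := ⟨_, rfl⟩
  have hDb : ‖D‖ ≤ B * (t₁ - t₀) := by rw [hD]; exact hAb t₁ hm1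
  rw [← hD, ← hP] at hθ
  -- Of the four multiples of `B * (t₁ - t₀)`, the motions of `z` and of `A` take one each and `D -
  -- tucker D P` takes two.
  have hzA : ∀ t ∈ Icc t₀ t₁, ‖z t - A t‖ ≤ e + 4 * B * (t₁ - t₀) + θ := fun t ht => by
    have h1 : z t - A t = (z t - z t₀) - ((Y₀ + D) - tucker (Y₀ + D) P) + (D - tucker D P)
        + (Y₀ - A t₀) - (A t - A t₀) := by
      have h2 : tucker (Y₀ + D) P = z t₀ + tucker D P := by
        rw [hz₀]; exact multiProd_add _ _ _
      rw [h2]; abel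
    rw [h1]
    have n1 := norm_sub_le ((z t - z t₀) - ((Y₀ + D) - tucker (Y₀ + D) P) + (D - tucker D P)
        + (Y₀ - A t₀)) (A t - A t₀)
    have n2 := norm_add_le ((z t - z t₀) - ((Y₀ + D) - tucker (Y₀ + D) P) + (D - tucker D P))
        (Y₀ - A t₀)
    have n3 := norm_add_le ((z t - z t₀) - ((Y₀ + D) - tucker (Y₀ + D) P)) (D - tucker D P)
    have n4 := norm_sub_le (z t - z t₀) ((Y₀ + D) - tucker (Y₀ + D) P)
    have n5 := norm_sub_le D (tucker D P)
    linarith [hzb t ht, hAb t ht, hPn D]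
  have hcons : ‖(z t₁ - z t₀) - tucker D P‖
      ≤ L * (e + 4 * B * (t₁ - t₀) + θ) * (t₁ - t₀) := by
    have hd : ∀ t ∈ Icc t₀ t₁, HasDerivWithinAt (fun t => z t - multiProdL (fun _ => P) (A t))
        (tucker (F t (z t)) P - multiProdL (fun _ => P) (F t (A t)))
        (Icc t₀ t₁) t := fun t ht =>
      (hzd t ht).sub (((multiProdL fun _ => P).restrictScalars ℝ).hasFDerivAt.comp_hasDerivWithinAt
        t (hA t ht))
    have h1 := norm_sub_le_of_hasDerivWithinAt (c := L * (e + 4 * B * (t₁ - t₀) + θ)) hd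
      (fun t ht => by
        rw [multiProdL_apply, ← tucker_eq_multiProd, hsub]
        exact (hPn _).trans ((hL t ht _ _).trans
          (mul_le_mul_of_nonneg_left (hzA t ht) hL0))) (by positivity) hm1
    have h2 : (z t₁ - z t₀) - tucker D P
        = (z t₁ - multiProdL (fun _ => P) (A t₁)) - (z t₀ - multiProdL (fun _ => P) (A t₀)) := by
      rw [hD, ← hsub]
      simp only [multiProdL_apply, ← tucker_eq_multiProd]
      abel
    rw [h2]
    exact h1
  have hz₁ : tucker (C t₁) U = z t₁ := by rw [hz]
  refine ⟨by rw [hz₁]; exact hsym, ?_⟩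
  have h1 : z t₁ - A t₁ = ((z t₁ - z t₀) - tucker D P) - ((Y₀ + D) - tucker (Y₀ + D) P)
      + (Y₀ - A t₀) := by
    have h2 : tucker (Y₀ + D) P = z t₀ + tucker D P := by
      rw [hz₀]; exact multiProd_add _ _ _
    rw [h2, hD]; abel
  rw [hz₁, h1]
  have n1 := norm_add_le (((z t₁ - z t₀) - tucker D P) - ((Y₀ + D) - tucker (Y₀ + D) P))
    (Y₀ - A t₀)
  have n2 := norm_sub_le ((z t₁ - z t₀) - tucker D P) ((Y₀ + D) - tucker (Y₀ + D) P)
  linarith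

/-! ### One full step and accumulation of errors -/

/-- The error after one step of the integrator. -/
theorem IsStep.bound {d n r : ℕ} [NeZero d] {s : SymmetryType} {F : ℝ → Tensor d n → Tensor d n}
    {A : ℝ → Tensor d n} {t₀ t₁ L B ε ρ e : ℝ} (ht : t₀ < t₁) (hL0 : 0 ≤ L) (hB0 : 0 ≤ B)
    (hε0 : 0 ≤ ε)
    (hA : ∀ t ∈ Icc t₀ t₁, HasDerivWithinAt A (F t (A t)) (Icc t₀ t₁) t)
    (hAs : ∀ t ∈ Icc t₀ t₁, HasSymmetry s (A t))
    (hF : ∀ t ∈ Icc t₀ t₁, ∀ Y, HasSymmetry s Y → HasSymmetry s (F t Y))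
    (hL : ∀ t ∈ Icc t₀ t₁, ∀ Y Z, ‖F t Y - F t Z‖ ≤ L * ‖Y - Z‖)
    (hB : ∀ t ∈ Icc t₀ t₁, ∀ Y, ‖F t Y‖ ≤ B)
    (hε : ∀ t ∈ Icc t₀ t₁, ∀ Y, HasMultilinearRank r Y → ‖Y - A t‖ < ρ →
      ‖F t Y - tangentProj r Y (F t Y)‖ ≤ ε)
    {C C₀ C₁ : Tensor d r} (hC : HasMultilinearRank r C) {U₀ U₁ : Matrix (Fin n) (Fin r) ℂ}
    (hU₀ : U₀ᴴ * U₀ = 1) (hs : HasSymmetry s (tucker C₀ U₀)) (he : ‖tucker C₀ U₀ - A t₀‖ ≤ e)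
    (hρ : e + (2 * B + 1) * (t₁ - t₀) ≤ ρ) (hstep : IsStep F t₀ t₁ C₀ U₀ C₁ U₁) :
    U₁ᴴ * U₁ = 1 ∧ HasSymmetry s (tucker C₁ U₁) ∧
      ‖tucker C₁ U₁ - A t₁‖ ≤
        e + d * ((t₁ - t₀) * (ε + 2 * L * (e + (2 * B + 1) * (t₁ - t₀)))) + (t₁ - t₀) *
        (L * (e + 4 * B * (t₁ - t₀)
          + d * ((t₁ - t₀) * (ε + 2 * L * (e + (2 * B + 1) * (t₁ - t₀)))))) := by
  obtain ⟨Q, S, V, K, R, c, hQ, hV, hK₀, hK, hU₁, hc₀, hc, rfl⟩ := hstep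
  -- For `v = Vᵀ` the entrywise conjugate of `V` is `vᴴ` by definition.
  have hθ := norm_sub_sandwich_le_of_kStep (v := Vᵀ) ht hL0 hB0 hε0 hA hL hB hε hC hU₀ he hρ hQ hV
    hK₀ hK hU₁
  have hW : HasSymmetry s (tucker C₀ U₀ + (A t₁ - A t₀)) :=
    (symmetricSubmodule d n s).add_mem hs
      ((symmetricSubmodule d n s).sub_mem (hAs t₁ ⟨ht.le, le_rfl⟩) (hAs t₀ ⟨le_rfl, ht.le⟩))
  have hθ' := (hW.norm_sub_tucker_le (P := U₁ * U₁ᴴ) (by simp)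
    (mul_conjTranspose_self_idem hU₁.1) 0).trans
    (mul_le_mul_of_nonneg_left hθ (Nat.cast_nonneg d))
  exact ⟨hU₁.1, cStep_bound ht hL0 hB0 hA hF hL hB hs he hU₁.1 hθ' hc₀ hc⟩

/-- A discrete Gronwall step. -/
theorem add_mul_exp_le {α h x b g : ℝ} (hα : 0 ≤ α) (hh : 0 ≤ h) (hx : 0 ≤ x) (hb : 0 ≤ b)
    (hg : 0 ≤ g) :
    (1 + α * h) * (Real.exp (α * x) * (b + x * g)) + h * g
      ≤ Real.exp (α * (x + h)) * (b + (x + h) * g) := by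
  have h1 : 1 + α * h ≤ Real.exp (α * h) := by linarith [Real.add_one_le_exp (α * h)]
  have h2 : 1 ≤ Real.exp (α * (x + h)) := Real.one_le_exp (by positivity)
  have h3 : Real.exp (α * (x + h)) = Real.exp (α * h) * Real.exp (α * x) := by
    rw [← Real.exp_add]; ring_nf
  have h4 : (1 + α * h) * (Real.exp (α * x) * (b + x * g))
      ≤ Real.exp (α * h) * (Real.exp (α * x) * (b + x * g)) :=
    mul_le_mul_of_nonneg_right h1 (by positivity)
  have h5 : h * g ≤ Real.exp (α * (x + h)) * (h * g) :=
    le_mul_of_one_le_left (by positivity) h2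
  rw [h3] at h5 ⊢
  nlinarith

end SymTucker
end

open SymTucker in
theorem theorem5p2 (d : ℕ) [NeZero d] (L B T : ℝ) (hL : 0 ≤ L) (hB : 0 ≤ B) (hT : 0 ≤ T) :
    ∃ c₀ c₁ c₂ : ℝ, 0 ≤ c₀ ∧ 0 ≤ c₁ ∧ 0 ≤ c₂ ∧
      ∀ (n r : ℕ) (s : SymmetryType) (F : ℝ → Tensor d n → Tensor d n) (A : ℝ → Tensor d n)
        (ε δ ρ h : ℝ) (N : ℕ) (C : ℕ → Tensor d r) (U : ℕ → Matrix (Fin n) (Fin r) ℂ),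
        -- `A` is the solution with (anti-)symmetric initial value of `A' = F(t, A)` on `[0, T]`
        (∀ t ∈ Icc 0 T, HasDerivWithinAt A (F t (A t)) (Icc 0 T) t) →
        HasSymmetry s (A 0) →
        -- `F` preserves the structure, is Lipschitz continuous and bounded
        (∀ t ∈ Icc 0 T, ∀ Y, HasSymmetry s Y → HasSymmetry s (F t Y)) →
        (∀ t ∈ Icc 0 T, ∀ Y Z, ‖F t Y - F t Z‖ ≤ L * ‖Y - Z‖) →
        (∀ t ∈ Icc 0 T, ∀ Y, ‖F t Y‖ ≤ B) →
        -- the non-tangential part of `F` is `ε`-small in the `ρ`-neighbourhood of `A(t)`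
        0 ≤ ε → 0 < ρ →
        (∀ t ∈ Icc 0 T, ∀ Y, HasMultilinearRank r Y → ‖Y - A t‖ < ρ →
          ‖F t Y - tangentProj r Y (F t Y)‖ ≤ ε) →
        -- `Y_k = C_k ×₁ U_k ⋯ ×_d U_k` is computed by the integrator from an initial value that
        -- is (anti-)symmetric, of multilinear rank `(r, …, r)` and `δ`-close to `A(0)`
        0 < h → IsRun F h N C U →
        HasSymmetry s (tucker (C 0) (U 0)) → HasMultilinearRank r (tucker (C 0) (U 0)) →
        ‖tucker (C 0) (U 0) - A 0‖ ≤ δ →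
        N * h ≤ T →
        -- the asserted bound does not exceed the size of the neighbourhood
        c₀ * δ + c₁ * ε + c₂ * h ≤ ρ →
        ‖tucker (C N) (U N) - A (N * h)‖ ≤ c₀ * δ + c₁ * ε + c₂ * h := by
  -- Bounding `1 + L * h` by `1 + L * T` turns the one-step estimate into `(1 + α * h) * e + h * (β
  -- * ε + γ * h)`.
  set α : ℝ := 2 * d * L * (1 + L * T) + L with hα
  set β : ℝ := d * (1 + L * T) with hβ
  set γ : ℝ := 2 * d * L * (2 * B + 1) * (1 + L * T) + 4 * L * B with hγ
  have hα0 : 0 ≤ α := by positivity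
  have hβ0 : 0 ≤ β := by positivity
  have hγ0 : 0 ≤ γ := by positivity
  -- The extra `2 * B + 1` in the last constant is not needed for the error; it makes the condition
  -- on `ρ` cover the region visited within a step.
  refine ⟨Real.exp (α * T), Real.exp (α * T) * T * β, Real.exp (α * T) * T * γ + (2 * B + 1),
    by positivity, by positivity, by positivity, ?_⟩
  intro n r s F A ε δ ρ h N C U hA hA0 hF hFL hFB hε0 _ hε hh hrun hY0 hY0r hδ hNT hρ
  obtain ⟨hU0, hsteps⟩ := hrun
  have hδ0 : 0 ≤ δ := (norm_nonneg _).trans hδ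
  -- Later cores may lose rank; the initial one serves as the perturbation direction in every step.
  have hC0 : HasMultilinearRank r (C 0) :=
    (hasMultilinearRank_multiProd_iff (W := fun _ => U 0) (W' := fun _ => (U 0)ᴴ)
      (fun _ => hU0) (C 0)).1 hY0r
  have hAs : ∀ t ∈ Icc 0 T, HasSymmetry s (A t) :=
    mem_of_hasDerivWithinAt (symmetricSubmodule d n s) hA hF hFL hA0
  have hg0 : 0 ≤ β * ε + γ * h := by positivity
  have hmono : ∀ x : ℝ, 0 ≤ x → x ≤ T →
      Real.exp (α * x) * (δ + x * (β * ε + γ * h))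
        ≤ Real.exp (α * T) * (δ + T * (β * ε + γ * h)) := fun x hx hxT => by gcongr
  have key : ∀ k : ℕ, k ≤ N → (U k)ᴴ * U k = 1 ∧ HasSymmetry s (tucker (C k) (U k)) ∧
      ‖tucker (C k) (U k) - A (k * h)‖
        ≤ Real.exp (α * (k * h)) * (δ + k * h * (β * ε + γ * h)) := by
    intro k
    induction k with
    | zero => intro _; exact ⟨hU0, hY0, by simpa using hδ⟩
    | succ k ih =>
      intro hk
      obtain ⟨hU, hs, he⟩ := ih (Nat.le_of_succ_le hk)
      have hx0 : 0 ≤ (k : ℝ) * h := by positivity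
      have hxT : ((k + 1 : ℕ) : ℝ) * h ≤ T :=
        (mul_le_mul_of_nonneg_right (Nat.cast_le.2 hk) hh.le).trans hNT
      have hx1 : ((k + 1 : ℕ) : ℝ) * h = k * h + h := by push_cast; ring
      rw [hx1] at hxT
      have hhT : h ≤ T := by linarith
      have hsub : Icc ((k : ℝ) * h) (k * h + h) ⊆ Icc 0 T := Icc_subset_Icc hx0 hxT
      obtain ⟨e, hedef⟩ : ∃ e, e = Real.exp (α * (k * h)) * (δ + k * h * (β * ε + γ * h)) :=
        ⟨_, rfl⟩
      have he0 : 0 ≤ e := by rw [hedef]; positivity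
      have hbd := hmono (k * h) hx0 (by linarith)
      rw [← hedef] at he hbd
      have hstep := hsteps k hk
      rw [hx1] at hstep ⊢
      have hlen : (k : ℝ) * h + h - k * h = h := by ring
      have hb := IsStep.bound (s := s) (e := e) (ε := ε) (ρ := ρ) (by linarith) hL hB hε0
        (fun t ht => (hA t (hsub ht)).mono hsub) (fun t ht => hAs t (hsub ht))
        (fun t ht => hF t (hsub ht)) (fun t ht => hFL t (hsub ht)) (fun t ht => hFB t (hsub ht))
        (fun t ht => hε t (hsub ht)) hC0 hU hs he (by rw [hlen]; linarith) hstep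
      rw [hlen] at hb
      refine ⟨hb.1, hb.2.1, hb.2.2.trans ?_⟩
      refine le_trans ?_ (add_mul_exp_le hα0 hh.le hx0 hδ0 hg0)
      rw [← hedef]
      -- This nonnegative product is exactly the loss in replacing `L * h` by `L * T`.
      have h1 : 0 ≤ (d : ℝ) * (h * (ε + 2 * L * (e + (2 * B + 1) * h))) * (L * (T - h)) := by
        have : 0 ≤ T - h := by linarith
        positivity
      rw [hα, hβ, hγ]
      nlinarith [h1]
  obtain ⟨_, _, he⟩ := key N le_rfl
  refine he.trans ((hmono _ (by positivity) hNT).trans ?_)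
  have : 0 ≤ (2 * B + 1) * h := by positivity
  linarith
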